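/- Let $F$ be a field of characteristic $0$ and let $z=(z_1,\dots,z_g)$ be freely noncommuting letters. A noncommutative (nc) rational expression is a syntactic combination of nc polynomials in $F\langle z\rangle$ by means of $+$, $\cdot$, ${}^{-1}$. For $m\ge 1$, $\operatorname{dom}_m r\subseteq M_m(F)^g$ is the set of tuples at which all inverses occurring in $r$ exist; $r$ is nondegenerate if $\operatorname{dom}_m r\neq\emptyset$ for some $m\ge1$. A nc rational function $\mathbb r$ is an equivalence class of nondegenerate expressions, where $r\sim s$ if $r(a)=s(a)$ for every $m\ge 1$ and every $a\in\operatorname{dom}_m r\cap\operatorname{dom}_m s$. Let $\operatorname{dom}_m\mathbb r$ be the union of $\operatorname{dom}_m r$ over the representatives $r$ of $\mathbb r$. Fix $m\ge1$, put $\mathcal A=M_m(F)$, and let $x=(x_1,\dots,x_g)$ be freely noncommuting letters. Let $\mathcal A\langle\!\langle x\rangle\!\rangle$ be the algebra of generalized power series over $\mathcal A$, i.e. the completion of the free product $\mathcal A *_F F\langle x\rangle$ in the $(x)$-adic topology, and for a series $S$ and a word $w=w_1\cdots w_\ell$ let $[S,w]\in\mathcal A^w=\mathcal A w_1\mathcal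 A\cdots w_\ell\mathcal A$ (the span of such products) be the part of $S$ belonging to $w$. A linear representation of $S$ of dimension $n\ge0$ consists of $\mathbf c\in\mathcal A^{1\times n}$, $\mathbf b\in\mathcal A^{n\times1}$ and matrices $A^{x_j}\in(\mathcal A^{x_j})^{n\times n}$, $1\le j\le g$, such that $[S,w]=\mathbf c A^{w_1}\cdots A^{w_\ell}\mathbf b$ for all words $w=w_1\cdots w_\ell$; equivalently, $S=\mathbf c\bigl(I_n-\sum_j A^{x_j}\bigr)^{-1}\mathbf b$. It is minimal if its dimension is smallest among all linear representations of $S$. A minimal (Sylvester) realization of $\mathbb r$ about $p\in\operatorname{dom}_m\mathbb r$ is a minimal linear representation of the expansion $r(x_1+p_1,\dots,x_g+p_g)\in\mathcal A\langle\!\langle x\rangle\!\rangle$, where $r$ is any representative of $\mathbb r$ that is defined at $p$. **Theorem.** Let $\mathbb r$ be a nc rational function. Then there is exactly one integer $n\ge 0$ such that for every $m\ge1$ and every $p\in\operatorname{dom}_m\mathbb r$, minimal realizations of $\mathbb r$ about $p$ exist and all of them have dimension $n$. In other words, the dimension of a minimal realization of $\mathbb r$ depends neither on the point $p$, nor on the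 matrix size $m$, nor on the representative $r$. (This number $n$ is the Sylvester degree of $\mathbb r$.) -/

import Mathlib

universe u v w

/-! ## Noncommutative rational expressions and functions -/

/-- Noncommutative rational expressions in the letters `z_0, …, z_{g-1}` over `F`: the syntactic
combinations of nc polynomials by means of `+`, `·` and `⁻¹`. -/
inductive NCRatExpr (F : Type u) [Field F] (g : ℕ) : Type u
  | poly (f : FreeAlgebra F (Fin g)) : NCRatExpr F g
  | add (r s : NCRatExpr F g) : NCRatExpr F g
  | mul (r s : NCRatExpr F g) : NCRatExpr F g
  | inv (r : NCRatExpr F g) : NCRatExpr F g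

namespace NCRatExpr

variable {F : Type u} [Field F] {g : ℕ} {R : Type v} [Semiring R] [Algebra F R]

/-- Evaluation of a rational expression at a tuple `a` of elements of a unital `F`-algebra `R`.
The value is meaningful when all inverses exist, see `DefinedAt`. -/
noncomputable def eval (a : Fin g → R) : NCRatExpr F g → R
  | poly f => FreeAlgebra.lift F a f
  | add r s => eval a r + eval a s
  | mul r s => eval a r * eval a s
  | inv r => Ring.inverse (eval a r)

/-- All inverses that occur in the expression exist at the tuple `a`. -/
def DefinedAt (a : Fin g → R) : NCRatExpr F g → Prop
  | poly _ => True
  | add r s => DefinedAt a r ∧ DefinedAt a s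
  | mul r s => DefinedAt a r ∧ DefinedAt a s
  | inv r => DefinedAt a r ∧ IsUnit (eval a r)

/-- The domain of a rational expression over the `m × m` matrices. -/
def dom (r : NCRatExpr F g) (m : ℕ) : Set (Fin g → Matrix (Fin m) (Fin m) F) :=
  {a | DefinedAt a r}

/-- An expression is nondegenerate if its domain is nonempty over matrices of some size `m ≥ 1`. -/
def Nondegenerate (r : NCRatExpr F g) : Prop :=
  ∃ m : ℕ, 0 < m ∧ (r.dom m).Nonempty

/-- The relation `r ∼ s`: the expressions agree wherever both are defined. -/
def Agree (r s : NCRatExpr F g) : Prop :=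
  ∀ m : ℕ, 0 < m → ∀ a ∈ r.dom m ∩ s.dom m, eval a r = eval a s

end NCRatExpr

/-- Noncommutative rational functions: nondegenerate rational expressions modulo `∼`. (Over an
infinite field `∼` is an equivalence relation on the nondegenerate expressions, so that `Quot`
is the set of its classes.) -/
def NCRatFun (F : Type u) [Field F] (g : ℕ) : Type u :=
  Quot (fun r s : {r : NCRatExpr F g // r.Nondegenerate} => r.1.Agree s.1)

namespace NCRatFun

variable {F : Type u} [Field F] {g : ℕ}

/-- The expression `r` is a representative of the rational function `f`. -/
def IsRepresentedBy (f : NCRatFun F g) (r : NCRatExpr F g) : Prop :=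
  ∃ h : r.Nondegenerate, f = Quot.mk _ ⟨r, h⟩

/-- `dom_m f`: the union of the domains over `m × m` matrices of the representatives of `f`. -/
def dom (f : NCRatFun F g) (m : ℕ) : Set (Fin g → Matrix (Fin m) (Fin m) F) :=
  {p | ∃ r : NCRatExpr F g, f.IsRepresentedBy r ∧ p ∈ r.dom m}

end NCRatFun

/-! ## Functions on words with the convolution product -/

/-- Functions from words over the alphabet `X` to a semiring `R`, multiplied by convolution:
`(S T)(w) = ∑_{uv = w} S(u) T(v)`. -/
def WordSeries (R : Type v) (X : Type w) : Type (max v w) := List X → R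

namespace WordSeries

variable {R : Type v} [Semiring R] {X : Type w}

instance : AddCommMonoid (WordSeries R X) := inferInstanceAs (AddCommMonoid (List X → R))

instance : One (WordSeries R X) :=
  ⟨fun w => match w with
    | [] => 1
    | _ :: _ => 0⟩

instance : Mul (WordSeries R X) :=
  ⟨fun S T w => ∑ i ∈ Finset.range (w.length + 1), S (w.take i) * T (w.drop i)⟩

theorem add_apply (S T : WordSeries R X) (w : List X) : (S + T) w = S w + T w := rfl

theorem zero_apply (w : List X) : (0 : WordSeries R X) w = 0 := rfl

theorem one_nil : (1 : WordSeries R X) [] = 1 := rfl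

theorem one_cons (x : X) (w : List X) : (1 : WordSeries R X) (x :: w) = 0 := rfl

theorem mul_apply (S T : WordSeries R X) (w : List X) :
    (S * T) w = ∑ i ∈ Finset.range (w.length + 1), S (w.take i) * T (w.drop i) := rfl

theorem mul_nil (S T : WordSeries R X) : (S * T) [] = S [] * T [] := by
  simp [mul_apply]

/-- The left shift `w ↦ S (x w)`. -/
def shift (x : X) (S : WordSeries R X) : WordSeries R X := fun w => S (x :: w)

theorem mul_cons (S T : WordSeries R X) (x : X) (w : List X) :
    (S * T) (x :: w) = (shift x S * T) w + S [] * T (x :: w) := by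
  rw [mul_apply, List.length_cons, Finset.sum_range_succ']
  rfl

theorem ext {R : Type v} {X : Type w} {S T : WordSeries R X} (h : ∀ w, S w = T w) : S = T := funext h

/-- Multiplication of all values by a constant from the left. -/
def constMul (a : R) (S : WordSeries R X) : WordSeries R X := fun w => a * S w

theorem zero_mul_apply (T : WordSeries R X) (w : List X) : ((0 : WordSeries R X) * T) w = 0 := by
  simp [mul_apply, zero_apply]

theorem one_mul_apply (T : WordSeries R X) (w : List X) : ((1 : WordSeries R X) * T) w = T w := by
  cases w with
  | nil => rw [mul_nil, one_nil, one_mul]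
  | cons x w =>
    have h : shift x (1 : WordSeries R X) = 0 := rfl
    rw [mul_cons, h, zero_mul_apply, one_nil, one_mul, zero_add]

theorem mul_one_apply (S : WordSeries R X) (w : List X) : (S * (1 : WordSeries R X)) w = S w := by
  induction w generalizing S with
  | nil => rw [mul_nil, one_nil, mul_one]
  | cons x w ih => rw [mul_cons, ih, one_cons, mul_zero, add_zero]; rfl

theorem add_mul_apply (S T U : WordSeries R X) (w : List X) :
    ((S + T) * U) w = (S * U) w + (T * U) w := by
  simp [mul_apply, add_apply, add_mul, Finset.sum_add_distrib]

theorem mul_add_apply (S T U : WordSeries R X) (w : List X) :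
    (S * (T + U)) w = (S * T) w + (S * U) w := by
  simp [mul_apply, add_apply, mul_add, Finset.sum_add_distrib]

theorem mul_assoc_apply (S T U : WordSeries R X) (w : List X) :
    (S * T * U) w = (S * (T * U)) w := by
  induction w generalizing S with
  | nil => simp only [mul_nil, mul_assoc]
  | cons x w ih =>
    have h : shift x (S * T) = shift x S * T + constMul (S []) (shift x T) :=
      ext fun v => mul_cons S T x v
    have h' : (constMul (S []) (shift x T) * U) w = S [] * (shift x T * U) w := by
      simp only [mul_apply, Finset.mul_sum, constMul, mul_assoc]
    rw [mul_cons, h, add_mul_apply, ih, h', mul_nil, mul_cons S, mul_cons T, mul_add, mul_assoc,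
      add_assoc]

instance : Semiring (WordSeries R X) where
  zero_mul T := ext (zero_mul_apply T)
  mul_zero S := ext fun w => by simp [mul_apply, zero_apply]
  one_mul T := ext (one_mul_apply T)
  mul_one S := ext (mul_one_apply S)
  left_distrib S T U := ext (mul_add_apply S T U)
  right_distrib S T U := ext (add_mul_apply S T U)
  mul_assoc S T U := ext (mul_assoc_apply S T U)

variable {F : Type u} [CommSemiring F] [Algebra F R]

instance : Module F (WordSeries R X) := inferInstanceAs (Module F (List X → R))

theorem smul_apply (α : F) (S : WordSeries R X) (w : List X) : (α • S) w = α • S w := rfl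

instance : Algebra F (WordSeries R X) :=
  Algebra.ofModule
    (fun α S T => ext fun w => by simp [mul_apply, smul_apply, Finset.smul_sum])
    (fun α S T => ext fun w => by simp [mul_apply, smul_apply, Finset.smul_sum])

end WordSeries

/-! ## Generalized polynomials and generalized series over an algebra `A` -/

section Generalized

variable (F : Type u) [Field F] (A : Type u) [Ring A] [Algebra F A] (g : ℕ)

/-- The two factors of the free product: `A` and the free algebra `F⟨x_0, …, x_{g-1}⟩`. -/
def GenPolyFactor : Bool → Type u
  | false => A
  | true => FreeAlgebra F (Fin g)

instance (i : Bool) : Semiring (GenPolyFactor F A g i) :=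
  match i with
  | false => inferInstanceAs (Semiring A)
  | true => inferInstanceAs (Semiring (FreeAlgebra F (Fin g)))

instance (i : Bool) : Algebra F (GenPolyFactor F A g i) :=
  match i with
  | false => inferInstanceAs (Algebra F A)
  | true => inferInstanceAs (Algebra F (FreeAlgebra F (Fin g)))

/-- The algebra `A⟨x⟩ = A *_F F⟨x⟩` of generalized polynomials over `A`. -/
abbrev GenPoly : Type u := LinearAlgebra.FreeProduct F (GenPolyFactor F A g)

namespace GenPoly

/-- The embedding of the coefficient algebra `A` into `A⟨x⟩`. -/
noncomputable def C : A →ₐ[F] GenPoly F A g :=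
  LinearAlgebra.FreeProduct.ι F (GenPolyFactor F A g) false

/-- The letter `x_i` as a generalized polynomial. -/
noncomputable def X (i : Fin g) : GenPoly F A g :=
  LinearAlgebra.FreeProduct.ι F (GenPolyFactor F A g) true (FreeAlgebra.ι F i)

/-- The copy of `A` in `A⟨x⟩`, as a subspace. -/
noncomputable def coeffs : Submodule F (GenPoly F A g) :=
  LinearMap.range (C F A g).toLinearMap

/-- The `A`-bimodule `A^x = ∑ A x A` generated by the letter `x`. -/
noncomputable def letterBimod (x : Fin g) : Submodule F (GenPoly F A g) :=
  coeffs F A g * Submodule.span F {X F A g x} * coeffs F A g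

/-- The `A`-bimodule `A^w = A^{w_1} ⋯ A^{w_ℓ}` of a word `w = w_1 ⋯ w_ℓ`, with `A^1 = A` for the
empty word. -/
noncomputable def wordBimod : List (Fin g) → Submodule F (GenPoly F A g)
  | [] => coeffs F A g
  | x :: w => letterBimod F A g x * wordBimod w

theorem coeffs_mul_coeffs_le : coeffs F A g * coeffs F A g ≤ coeffs F A g := by
  rw [Submodule.mul_le]
  rintro _ ⟨a, rfl⟩ _ ⟨b, rfl⟩
  exact ⟨a * b, map_mul (C F A g) a b⟩

theorem one_mem_coeffs : (1 : GenPoly F A g) ∈ coeffs F A g :=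
  ⟨1, map_one (C F A g)⟩

theorem coeffs_mul_wordBimod_le (w : List (Fin g)) :
    coeffs F A g * wordBimod F A g w ≤ wordBimod F A g w := by
  cases w with
  | nil => exact coeffs_mul_coeffs_le F A g
  | cons x w =>
    simp only [wordBimod, letterBimod, ← mul_assoc]
    gcongr
    exact coeffs_mul_coeffs_le F A g

theorem wordBimod_mul_le (u v : List (Fin g)) :
    wordBimod F A g u * wordBimod F A g v ≤ wordBimod F A g (u ++ v) := by
  induction u with
  | nil => exact coeffs_mul_wordBimod_le F A g v
  | cons x u ih =>
    simp only [wordBimod, List.cons_append, mul_assoc]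
    gcongr

theorem X_mem_wordBimod (x : Fin g) : X F A g x ∈ wordBimod F A g [x] := by
  have h1 := one_mem_coeffs F A g
  have h : (1 * X F A g x * 1) * 1 ∈ wordBimod F A g [x] :=
    Submodule.mul_mem_mul
      (Submodule.mul_mem_mul (Submodule.mul_mem_mul h1 (Submodule.mem_span_singleton_self _)) h1) h1
  simpa using h

end GenPoly

/-- The algebra `A⟨⟨x⟩⟩` of generalized series over `A`, the completion of `A⟨x⟩` in the
`(x)`-adic topology: a series `S` is the family of its homogeneous parts `[S, w] ∈ A^w`, one for
each word `w`, and `[S T, w] = ∑_{uv = w} [S, u] [T, v]`. -/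
noncomputable def GenSeries : Subalgebra F (WordSeries (GenPoly F A g) (Fin g)) where
  carrier := {S | ∀ w, S w ∈ GenPoly.wordBimod F A g w}
  mul_mem' := fun {S T} hS hT w => by
    rw [WordSeries.mul_apply]
    refine Submodule.sum_mem _ fun i _ => ?_
    have h := GenPoly.wordBimod_mul_le F A g (w.take i) (w.drop i)
      (Submodule.mul_mem_mul (hS (w.take i)) (hT (w.drop i)))
    rwa [List.take_append_drop] at h
  add_mem' := fun {S T} hS hT w => Submodule.add_mem _ (hS w) (hT w)
  algebraMap_mem' := fun α w => by
    rw [Algebra.algebraMap_eq_smul_one, WordSeries.smul_apply]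
    refine Submodule.smul_mem _ _ ?_
    cases w with
    | nil => exact GenPoly.one_mem_coeffs F A g
    | cons x w => exact Submodule.zero_mem _

namespace GenSeries

/-- The series `x_i + a`. -/
noncomputable def letterAdd (i : Fin g) (a : A) : GenSeries F A g :=
  ⟨fun w => match w with
    | [] => GenPoly.C F A g a
    | [x] => if x = i then GenPoly.X F A g i else 0
    | _ :: _ :: _ => 0, by
    intro w
    match w with
    | [] => exact ⟨a, rfl⟩
    | [x] =>
      by_cases h : x = i
      · subst h
        simpa using GenPoly.X_mem_wordBimod F A g x
      · simp [h]
    | _ :: _ :: _ => exact Submodule.zero_mem _⟩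

end GenSeries

/-- Linear representations of dimension `n` over `A`: a row `c ∈ A^{1×n}`, a column
`b ∈ A^{n×1}` and matrices `A^x ∈ (A^x)^{n×n}`, one for each letter `x`. -/
structure LinRep (n : ℕ) where
  c : Fin n → A
  mat : Fin g → Matrix (Fin n) (Fin n) (GenPoly F A g)
  mat_mem : ∀ x i j, mat x i j ∈ GenPoly.letterBimod F A g x
  b : Fin n → A

variable {F A g}

/-- `c A^w b`, where `A^w = A^{w_1} ⋯ A^{w_ℓ}`. -/
noncomputable def LinRep.value {n : ℕ} (ρ : LinRep F A g n) (w : List (Fin g)) : GenPoly F A g :=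
  ∑ i, ∑ j, GenPoly.C F A g (ρ.c i) * (w.map ρ.mat).prod i j * GenPoly.C F A g (ρ.b j)

/-- `ρ` is a linear representation of the series `S`: `[S, w] = c A^w b` for all words `w`. -/
def LinRep.Represents {n : ℕ} (ρ : LinRep F A g n) (S : GenSeries F A g) : Prop :=
  ∀ w, S.1 w = ρ.value w

/-- `ρ` is a minimal representation of `S`: a representation of `S` whose dimension is smallest
among all the representations of `S`. -/
def LinRep.IsMinimalFor {n : ℕ} (ρ : LinRep F A g n) (S : GenSeries F A g) : Prop :=
  ρ.Represents S ∧ ∀ (k : ℕ) (σ : LinRep F A g k), σ.Represents S → n ≤ k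

/-- The expansion `r(x + p)` of a rational expression `r` about the point `p`. -/
noncomputable def NCRatExpr.expansion (r : NCRatExpr F g) (p : Fin g → A) : GenSeries F A g :=
  r.eval (fun i => GenSeries.letterAdd F A g i (p i))

end Generalized

/-- `ρ` is a minimal realization of the rational function `f` about the point `p` (over
`A = M_m(F)`): `f` has a representative `r` that is defined at `p` such that `ρ` is a minimal
representation of the expansion of `r` about `p`. -/
def NCRatFun.IsMinimalRealization {F : Type u} [Field F] {g m : ℕ} (f : NCRatFun F g)
    (p : Fin g → Matrix (Fin m) (Fin m) F) {n : ℕ}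
    (ρ : LinRep F (Matrix (Fin m) (Fin m) F) g n) : Prop :=
  ∃ r : NCRatExpr F g, f.IsRepresentedBy r ∧ p ∈ r.dom m ∧ ρ.IsMinimalFor (r.expansion p)

/-! Over `M_m(F)`, replace each letter `x_k` by an `m × m` matrix of noncommuting variables. This is
faithful on every `A^w`, and a linear representation of dimension `n` becomes an ordinary state
space system over `F` on `F^(nm)`; every such system arises (`LinRep.represents_iff`,
`LinRep.exists_stateOp_eq`). By the Hankel criterion over a field, an expansion about `p` has a
representation of dimension `n` iff `h ≤ n m`, where `h` is the dimension of its Hankel column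
space. Hence it suffices that `h / m` is the same for all points, sizes and representatives.

One expression, two points of one size: linearization gives one scalar pencil with `r = c L⁻¹ b`
over all algebras. About `p` the state operators are `-L(p)⁻¹ N_y`, and `L(q) - L(p)` is a
combination of the `N_y`. A subspace `U` invariant at `p` has `N_y U ⊆ L(p) U`, so `L(q) U ⊆ L(p)
U`, with equality by dimension, and `U` is invariant at `q`. Thus the reachable and unobservable
subspaces, and with them `h`, do not depend on the point (`IsDescriptorSeries.finrank_eq`).

Two sizes: passing from `p` to `p ⊗ 1_k` multiplies `h` by `k`
(`finrank_hankelSpace_amplifySeries`).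

Two representatives: after ampliation to a common size, both are defined at a common point of a
line, since nonzero polynomials over an infinite field have a common nonzero. There the expansions
coincide, because each coefficient is an entry of the value at a tuple of block triangular matrices
(`Agree.genericSeries_eq`). Together, `k h_r(p) = m h_s(q)` (`Agree.mul_hankelRank_eq`). -/

open Matrix
open scoped Kronecker

/-! ## Rational expressions: functoriality and linearization -/

namespace NCRatExpr

variable {F : Type u} [Field F] {g : ℕ}

/-- Homomorphisms of algebras preserve definedness and values of rational expressions. -/
theorem definedAt_map {R : Type v} {R' : Type w} [Semiring R] [Algebra F R] [Semiring R']
    [Algebra F R'] (φ : R →ₐ[F] R') {a : Fin g → R} {r : NCRatExpr F g} (h : r.DefinedAt a) :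
    r.DefinedAt (fun k => φ (a k)) ∧ r.eval (fun k => φ (a k)) = φ (r.eval a) := by
  induction r with
  | poly f =>
    refine ⟨trivial, ?_⟩
    have : FreeAlgebra.lift F (fun k => φ (a k)) = φ.comp (FreeAlgebra.lift F a) := by
      ext k; simp
    simp [eval, this]
  | add r s hr hs =>
    obtain ⟨h1, h2⟩ := h
    exact ⟨⟨(hr h1).1, (hs h2).1⟩, by simp [eval, (hr h1).2, (hs h2).2]⟩
  | mul r s hr hs =>
    obtain ⟨h1, h2⟩ := h
    exact ⟨⟨(hr h1).1, (hs h2).1⟩, by simp [eval, (hr h1).2, (hs h2).2]⟩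
  | inv r hr =>
    obtain ⟨h1, h2⟩ := h
    have h3 := (hr h1).2
    refine ⟨⟨(hr h1).1, by rw [h3]; exact h2.map φ⟩, ?_⟩
    obtain ⟨y, hy⟩ := h2
    simp only [eval, h3, ← hy, Ring.inverse_unit]
    exact Ring.inverse_unit (Units.map (φ : R →* R') y)

end NCRatExpr

/-- A linear matrix pencil `L₀ + ∑ L_k z_k` together with a row `c` and a column `b`. -/
structure LinPencil (F : Type u) (g : ℕ) (ι : Type) where
  c : ι → F
  b : ι → F
  L₀ : Matrix ι ι F
  L : Fin g → Matrix ι ι F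

namespace LinPencil

variable {F : Type u} [Field F] {g : ℕ} {R : Type v} [Ring R] [Algebra F R] {ι κ : Type}

/-- The value of the pencil at a tuple of elements of an algebra. -/
def atPoint (d : LinPencil F g ι) (a : Fin g → R) : Matrix ι ι R :=
  Matrix.of fun i j => algebraMap F R (d.L₀ i j) + ∑ k, d.L k i j • a k

/-- `c L(a)⁻¹ b = v`, and `L(a)` is injective on columns. -/
def RealizesAt [Fintype ι] (d : LinPencil F g ι) (a : Fin g → R) (v : R) : Prop :=
  (∃ x : ι → R, d.atPoint a *ᵥ x = (fun i => algebraMap F R (d.b i)) ∧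
    (fun i => algebraMap F R (d.c i)) ⬝ᵥ x = v) ∧
  ∀ x : ι → R, d.atPoint a *ᵥ x = 0 → x = 0

/-- The pencil of a constant. -/
def const (g : ℕ) (α : F) : LinPencil F g Unit where
  c _ := α
  b _ := 1
  L₀ := 1
  L _ := 0

theorem const_realizesAt (α : F) (a : Fin g → R) :
    (const g α).RealizesAt a (algebraMap F R α) := by
  have h : (const g α).atPoint a = 1 := by
    ext i j
    simp [atPoint, const]
  refine ⟨⟨fun _ => 1, ?_, ?_⟩, ?_⟩
  · rw [h, one_mulVec]
    simp [const]
  · simp [dotProduct, const]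
  · intro x hx
    simpa [h] using hx

/-- The pencil of a letter. -/
def letter (F : Type u) [Field F] (k : Fin g) : LinPencil F g Bool where
  c i := if i then 0 else 1
  b i := if i then 1 else 0
  L₀ := 1
  L l := if l = k then Matrix.of fun i j => if i = false ∧ j = true then -1 else 0 else 0

theorem letter_atPoint (k : Fin g) (a : Fin g → R) (x : Bool → R) :
    (letter F k).atPoint a *ᵥ x = fun i : Bool => if i then x true else x false - a k * x true := by
  have h : ∀ i j : Bool, ∑ l, (letter F k).L l i j • a l =
      if i = false ∧ j = true then - a k else 0 := by
    intro i j
    rw [Finset.sum_eq_single k]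
    · by_cases hij : i = false ∧ j = true <;> simp [letter, hij]
    · intro l _ hl
      simp [letter, hl]
    · simp
  funext i
  simp only [mulVec, dotProduct, atPoint, of_apply, h, Fintype.sum_bool]
  cases i
  · simp [letter, sub_eq_neg_add]
  · simp [letter]

theorem letter_realizesAt (k : Fin g) (a : Fin g → R) :
    (letter F k).RealizesAt a (a k) := by
  refine ⟨⟨fun i : Bool => if i then 1 else a k, ?_, ?_⟩, ?_⟩
  · rw [letter_atPoint]
    funext (i : Bool)
    cases i <;> simp [letter]
  · change ∑ i : Bool, _ = _
    simp [letter]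
  · intro x hx
    rw [letter_atPoint] at hx
    have h1 : x true = 0 := by simpa using congrFun hx true
    have h2 : x false = 0 := by simpa [h1] using congrFun hx false
    funext (i : Bool)
    cases i <;> assumption

/-- The pencil of a sum. -/
def add (d : LinPencil F g ι) (e : LinPencil F g κ) : LinPencil F g (ι ⊕ κ) where
  c := Sum.elim d.c e.c
  b := Sum.elim d.b e.b
  L₀ := fromBlocks d.L₀ 0 0 e.L₀
  L k := fromBlocks (d.L k) 0 0 (e.L k)

theorem add_atPoint (d : LinPencil F g ι) (e : LinPencil F g κ) (a : Fin g → R) :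
    (d.add e).atPoint a = fromBlocks (d.atPoint a) 0 0 (e.atPoint a) := by
  ext (i | i) (j | j) <;> simp [atPoint, add]

theorem sumElim_algebraMap (x : ι → F) (y : κ → F) :
    (fun i => algebraMap F R (Sum.elim x y i)) =
      Sum.elim (fun i => algebraMap F R (x i)) (fun i => algebraMap F R (y i)) := by
  ext (i | i) <;> rfl

theorem add_realizesAt [Fintype ι] [Fintype κ] {d : LinPencil F g ι} {e : LinPencil F g κ} {a : Fin g → R} {v w : R} (hd : d.RealizesAt a v)
    (he : e.RealizesAt a w) : (d.add e).RealizesAt a (v + w) := by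
  obtain ⟨⟨x, hx, hv⟩, hd⟩ := hd
  obtain ⟨⟨y, hy, hw⟩, he⟩ := he
  refine ⟨⟨(Sum.elim x y : ι ⊕ κ → R), ?_, ?_⟩, ?_⟩
  · rw [add_atPoint]
    rw [fromBlocks_mulVec]
    simp only [Sum.elim_comp_inl, Sum.elim_comp_inr, zero_mulVec, add_zero, zero_add, hx, hy]
    exact (sumElim_algebraMap d.b e.b).symm
  · change (fun i => algebraMap F R (Sum.elim d.c e.c i)) ⬝ᵥ Sum.elim x y = _
    rw [sumElim_algebraMap, sumElim_dotProduct_sumElim, hv, hw]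
  · intro z hz
    rw [add_atPoint] at hz
    rw [fromBlocks_mulVec] at hz
    simp only [zero_mulVec, add_zero, zero_add] at hz
    have h1 := hd _ (funext fun i => congrFun hz (Sum.inl i))
    have h2 := he _ (funext fun i => congrFun hz (Sum.inr i))
    ext (i | i)
    · exact congrFun h1 i
    · exact congrFun h2 i

/-- The pencil of a product. -/
def mul (d : LinPencil F g ι) (e : LinPencil F g κ) : LinPencil F g (ι ⊕ κ) where
  c := Sum.elim d.c 0
  b := Sum.elim 0 e.b
  L₀ := fromBlocks d.L₀ (-vecMulVec d.b e.c) 0 e.L₀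
  L k := fromBlocks (d.L k) 0 0 (e.L k)

theorem mul_atPoint (d : LinPencil F g ι) (e : LinPencil F g κ) (a : Fin g → R) :
    (d.mul e).atPoint a = fromBlocks (d.atPoint a) (-vecMulVec (fun i => algebraMap F R (d.b i))
      (fun i => algebraMap F R (e.c i))) 0 (e.atPoint a) := by
  ext (i | i) (j | j) <;> simp [atPoint, mul, vecMulVec]

/-- Columns form a right module over the noncommutative `R`, and matrices acting from the left are
linear for it. This is what allows solutions of pencil equations to be rescaled. -/
theorem mulVec_mul_right [Fintype κ] (M : Matrix ι κ R) (x : κ → R) (r : R) :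
    (M *ᵥ fun j => x j * r) = fun i => (M *ᵥ x) i * r := by
  funext i
  simp [mulVec, dotProduct, Finset.sum_mul, mul_assoc]

theorem dotProduct_mul_right [Fintype κ] (c x : κ → R) (r : R) :
    (c ⬝ᵥ fun j => x j * r) = (c ⬝ᵥ x) * r := by
  simp [dotProduct, Finset.sum_mul, mul_assoc]

theorem vecMulVec_mulVec' [Fintype κ] (b : ι → R) (c x : κ → R) :
    vecMulVec b c *ᵥ x = fun i => b i * (c ⬝ᵥ x) := by
  funext i
  simp [mulVec, dotProduct, vecMulVec, Finset.mul_sum, mul_assoc]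

/-- The lower block gives `y` with output `w`; the upper block then reads `L x' = b w`, solved by
`x' = x w`. -/
theorem mul_realizesAt [Fintype ι] [Fintype κ] {d : LinPencil F g ι} {e : LinPencil F g κ} {a : Fin g → R} {v w : R} (hd : d.RealizesAt a v)
    (he : e.RealizesAt a w) : (d.mul e).RealizesAt a (v * w) := by
  obtain ⟨⟨x, hx, hv⟩, hd⟩ := hd
  obtain ⟨⟨y, hy, hw⟩, he⟩ := he
  refine ⟨⟨(Sum.elim (fun i => x i * w) y : ι ⊕ κ → R), ?_, ?_⟩, ?_⟩
  · rw [mul_atPoint]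
    rw [fromBlocks_mulVec]
    simp only [Sum.elim_comp_inl, Sum.elim_comp_inr, zero_mulVec, hy, neg_mulVec,
      mulVec_mul_right, hx, vecMulVec_mulVec', hw]
    ext (i | i) <;> simp [mul]
  · change (fun i => algebraMap F R (Sum.elim d.c 0 i)) ⬝ᵥ Sum.elim _ y = _
    rw [sumElim_algebraMap, sumElim_dotProduct_sumElim, dotProduct_mul_right, hv]
    simp [dotProduct]
  · intro z hz
    rw [mul_atPoint] at hz
    rw [fromBlocks_mulVec] at hz
    simp only [zero_mulVec, zero_add, neg_mulVec] at hz
    have h2 := he _ (funext fun i => congrFun hz (Sum.inr i))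
    rw [h2] at hz
    have h1 := hd _ (funext fun i => by simpa using congrFun hz (Sum.inl i))
    ext (i | i)
    · exact congrFun h1 i
    · exact congrFun h2 i

/-- The pencil of an inverse. -/
def inv (d : LinPencil F g ι) : LinPencil F g (ι ⊕ Unit) where
  c := Sum.elim 0 1
  b := Sum.elim 0 (-1)
  L₀ := fromBlocks d.L₀ (vecMulVec d.b 1) (vecMulVec 1 d.c) 0
  L k := fromBlocks (d.L k) 0 0 0

theorem inv_atPoint (d : LinPencil F g ι) (a : Fin g → R) :
    (d.inv).atPoint a = fromBlocks (d.atPoint a) (vecMulVec (fun i => algebraMap F R (d.b i))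
      (1 : Unit → R)) (vecMulVec (1 : Unit → R) (fun i => algebraMap F R (d.c i))) 0 := by
  ext (i | i) (j | j) <;> simp [atPoint, inv, vecMulVec]

/-- The pencil is bordered by its own `b` and `c`, so its Schur complement is `-c L⁻¹ b = -v`; the
sign is absorbed in the entry `-1` of the new column. For injectivity, a kernel vector with last
entry `t` has upper part `-x t`, and its last row gives `v t = 0`. -/
theorem inv_realizesAt [Fintype ι] {d : LinPencil F g ι} {a : Fin g → R} {v : R} (hd : d.RealizesAt a v)
    (hu : IsUnit v) : d.inv.RealizesAt a (Ring.inverse v) := by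
  obtain ⟨⟨x, hx, hv⟩, hd⟩ := hd
  obtain ⟨u, rfl⟩ := hu
  rw [Ring.inverse_unit]
  refine ⟨⟨(Sum.elim (fun i => x i * (-(↑u⁻¹ : R))) (fun _ => (↑u⁻¹ : R)) : ι ⊕ Unit → R),
    ?_, ?_⟩, ?_⟩
  · rw [inv_atPoint]
    rw [fromBlocks_mulVec]
    simp only [Sum.elim_comp_inl, Sum.elim_comp_inr, zero_mulVec, add_zero,
      mulVec_mul_right, hx, vecMulVec_mulVec', hv]
    ext (i | i) <;> simp [inv, dotProduct]
  · change (fun i => algebraMap F R (Sum.elim 0 1 i)) ⬝ᵥ Sum.elim _ _ = _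
    rw [sumElim_algebraMap, sumElim_dotProduct_sumElim]
    simp [dotProduct]
  · intro z hz
    rw [inv_atPoint] at hz
    rw [fromBlocks_mulVec] at hz
    simp only [zero_mulVec, add_zero, vecMulVec_mulVec'] at hz
    have h1 : ∀ i, (d.atPoint a *ᵥ (z ∘ Sum.inl)) i + algebraMap F R (d.b i) * z (Sum.inr ()) = 0 := by
      intro i
      simpa [dotProduct] using congrFun hz (Sum.inl i)
    have h2 : (fun i => algebraMap F R (d.c i)) ⬝ᵥ (z ∘ Sum.inl) = 0 := by
      simpa using congrFun hz (Sum.inr ())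
    have h3 : z ∘ Sum.inl + (fun i => x i * z (Sum.inr ())) = 0 := by
      apply hd
      rw [mulVec_add, mulVec_mul_right, hx]
      exact funext h1
    have h4 : z (Sum.inr ()) = 0 := by
      have := congrArg (fun y => (fun i => algebraMap F R (d.c i)) ⬝ᵥ y) h3
      simp only [dotProduct_add, h2, dotProduct_mul_right, hv, zero_add, dotProduct_zero] at this
      simpa using this
    have h5 : z ∘ Sum.inl = 0 := by simpa [h4, Pi.zero_def] using h3
    ext (i | i)
    · exact congrFun h5 i
    · exact h4

/-- Every noncommutative polynomial is realized by a pencil. -/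
theorem exists_realizesAt_freeAlgebra (f : FreeAlgebra F (Fin g)) :
    ∃ (ι : Type) (_ : Fintype ι) (d : LinPencil F g ι), ∀ (R : Type v) [Ring R] [Algebra F R] (a : Fin g → R),
      d.RealizesAt a (FreeAlgebra.lift F a f) := by
  induction f using FreeAlgebra.induction with
  | grade0 α => exact ⟨_, inferInstance, const g α, fun R _ _ a => by simpa using const_realizesAt α a⟩
  | grade1 k => exact ⟨_, inferInstance, letter F k, fun R _ _ a => by simpa using letter_realizesAt k a⟩
  | add f h hf hh =>
    obtain ⟨ι, _, d, hd⟩ := hf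
    obtain ⟨κ, _, e, he⟩ := hh
    exact ⟨_, inferInstance, d.add e, fun R _ _ a => by simpa using add_realizesAt (hd R a) (he R a)⟩
  | mul f h hf hh =>
    obtain ⟨ι, _, d, hd⟩ := hf
    obtain ⟨κ, _, e, he⟩ := hh
    exact ⟨_, inferInstance, d.mul e, fun R _ _ a => by simpa using mul_realizesAt (hd R a) (he R a)⟩

end LinPencil

namespace NCRatExpr

/-- Every rational expression is realized by a pencil, over all algebras. -/
theorem exists_realizesAt {F : Type u} [Field F] {g : ℕ} (r : NCRatExpr F g) :
    ∃ (ι : Type) (_ : Fintype ι) (d : LinPencil F g ι), ∀ (R : Type v) [Ring R] [Algebra F R] (a : Fin g → R),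
      r.DefinedAt a → d.RealizesAt a (r.eval a) := by
  induction r with
  | poly f =>
    obtain ⟨ι, _, d, hd⟩ := LinPencil.exists_realizesAt_freeAlgebra f
    exact ⟨_, inferInstance, d, fun R _ _ a _ => hd R a⟩
  | add r s hr hs =>
    obtain ⟨ι, _, d, hd⟩ := hr
    obtain ⟨κ, _, e, he⟩ := hs
    exact ⟨_, inferInstance, d.add e, fun R _ _ a h => LinPencil.add_realizesAt (hd R a h.1) (he R a h.2)⟩
  | mul r s hr hs =>
    obtain ⟨ι, _, d, hd⟩ := hr
    obtain ⟨κ, _, e, he⟩ := hs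
    exact ⟨_, inferInstance, d.mul e, fun R _ _ a h => LinPencil.mul_realizesAt (hd R a h.1) (he R a h.2)⟩
  | inv r hr =>
    obtain ⟨ι, _, d, hd⟩ := hr
    exact ⟨_, inferInstance, d.inv, fun R _ _ a h => LinPencil.inv_realizesAt (hd R a h.1) h.2⟩

end NCRatExpr

/-! ## Hankel spaces of matrix valued series and their realizations -/

namespace WordSeries

variable {F : Type u} [Field F] {n : Type} {Y : Type w}

/-- The span of the columns of the Hankel matrix of a matrix valued series. -/
def hankelSpace (S : WordSeries (Matrix n n F) Y) : Submodule F (List Y × n → F) :=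
  Submodule.span F (Set.range fun vj : List Y × n => fun ui : List Y × n =>
    S (ui.1 ++ vj.1) ui.2 vj.2)

variable {V : Type v} [AddCommGroup V] [Module F V]

/-- The series `w ↦ c A^w b` given by state space data over a field. -/
def Realizes (A : Y → Module.End F V) (b : n → V) (c : n → V →ₗ[F] F)
    (S : WordSeries (Matrix n n F) Y) : Prop :=
  ∀ w i j, S w i j = c i ((w.map A).prod (b j))

/-- The reachable subspace. -/
def reach (A : Y → Module.End F V) (b : n → V) : Submodule F V :=
  Submodule.span F (Set.range fun wj : List Y × n => (wj.1.map A).prod (b wj.2))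

/-- The observability map. -/
def obs (A : Y → Module.End F V) (c : n → V →ₗ[F] F) : V →ₗ[F] (List Y × n → F) :=
  LinearMap.pi fun ui => c ui.2 ∘ₗ (ui.1.map A).prod

theorem obs_apply (A : Y → Module.End F V) (c : n → V →ₗ[F] F) (x : V) (ui : List Y × n) :
    obs A c x ui = c ui.2 ((ui.1.map A).prod x) := rfl

/-- With `mem_reach` and `map_mem_reach` this makes `reach` the least invariant subspace containing
the inputs, a description in which systems with different operators can be compared. -/
theorem reach_le {A : Y → Module.End F V} {b : n → V} {U : Submodule F V} (hb : ∀ j, b j ∈ U)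
    (hA : ∀ y, ∀ x ∈ U, A y x ∈ U) : reach A b ≤ U := by
  rw [reach, Submodule.span_le]
  rintro _ ⟨⟨w, j⟩, rfl⟩
  induction w with
  | nil => exact hb j
  | cons y w ih => simpa using hA y _ ih

theorem mem_reach (A : Y → Module.End F V) (b : n → V) (j : n) : b j ∈ reach A b :=
  Submodule.subset_span ⟨([], j), rfl⟩

theorem map_mem_reach {A : Y → Module.End F V} {b : n → V} (y : Y) {x : V} (hx : x ∈ reach A b) :
    A y x ∈ reach A b := by
  suffices h : reach A b ≤ (reach A b).comap (A y) from h hx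
  conv_lhs => rw [reach]
  rw [Submodule.span_le]
  rintro _ ⟨⟨w, j⟩, rfl⟩
  exact Submodule.subset_span ⟨(y :: w, j), by simp⟩

/-- Dually, the unobservable subspace is the greatest invariant subspace on which all outputs
vanish. -/
theorem le_ker_obs {A : Y → Module.End F V} {c : n → V →ₗ[F] F} {U : Submodule F V}
    (hc : ∀ i, ∀ x ∈ U, c i x = 0) (hA : ∀ y, ∀ x ∈ U, A y x ∈ U) :
    U ≤ LinearMap.ker (obs A c) := by
  intro x hx
  rw [LinearMap.mem_ker]
  funext ⟨u, i⟩
  rw [obs_apply]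
  refine hc i _ ?_
  change (u.map A).prod x ∈ U
  clear i
  induction u with
  | nil => simpa using hx
  | cons y u ih => simpa using hA y _ ih

theorem eq_zero_of_mem_ker_obs {A : Y → Module.End F V} {c : n → V →ₗ[F] F} {x : V}
    (hx : x ∈ LinearMap.ker (obs A c)) (i : n) : c i x = 0 :=
  congrFun (LinearMap.mem_ker.1 hx) ([], i)

theorem map_mem_ker_obs {A : Y → Module.End F V} {c : n → V →ₗ[F] F} (y : Y) {x : V}
    (hx : x ∈ LinearMap.ker (obs A c)) : A y x ∈ LinearMap.ker (obs A c) := by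
  rw [LinearMap.mem_ker]
  funext ⟨u, i⟩
  have := congrFun (LinearMap.mem_ker.1 hx) (u ++ [y], i)
  simpa [obs_apply] using this

/-- The Hankel matrix factors as observability times reachability, since `S(uv) = c A^u (A^v b)`. -/
theorem Realizes.hankelSpace_eq {A : Y → Module.End F V} {b : n → V} {c : n → V →ₗ[F] F}
    {S : WordSeries (Matrix n n F) Y} (h : Realizes A b c S) :
    hankelSpace S = (reach A b).map (obs A c) := by
  rw [hankelSpace, reach, Submodule.map_span, ← Set.range_comp]
  congr 2
  funext ⟨v, j⟩ ⟨u, i⟩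
  simp [obs_apply, h (u ++ v) i j]

theorem Realizes.finrank_hankelSpace_le [FiniteDimensional F V] {A : Y → Module.End F V}
    {b : n → V} {c : n → V →ₗ[F] F} {S : WordSeries (Matrix n n F) Y} (h : Realizes A b c S) :
    Module.finrank F (hankelSpace S) ≤ Module.finrank F V := by
  rw [h.hankelSpace_eq]
  exact (Submodule.finrank_map_le _ _).trans (Submodule.finrank_le _)

theorem Realizes.finiteDimensional [FiniteDimensional F V] {A : Y → Module.End F V}
    {b : n → V} {c : n → V →ₗ[F] F} {S : WordSeries (Matrix n n F) Y} (h : Realizes A b c S) :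
    FiniteDimensional F (hankelSpace S) := by
  rw [h.hankelSpace_eq]
  infer_instance

/-- The canonical realization of a series on its Hankel space. -/
theorem exists_realizes_hankelSpace (S : WordSeries (Matrix n n F) Y) :
    ∃ (A : Y → Module.End F (hankelSpace S)) (b : n → hankelSpace S)
      (c : n → hankelSpace S →ₗ[F] F), Realizes A b c S := by
  -- Shifting the row index `u ↦ u y` sends the column of `v` to the column of `y v`. The inputs are
  -- the columns of the empty word, the outputs the entries in its rows.
  let σ (y : Y) : (List Y × n → F) →ₗ[F] (List Y × n → F) :=
    LinearMap.funLeft F F fun ui => (ui.1 ++ [y], ui.2)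
  have hσ (y : Y) : ∀ f ∈ hankelSpace S, σ y f ∈ hankelSpace S := by
    intro f hf
    suffices h : hankelSpace S ≤ (hankelSpace S).comap (σ y) from h hf
    conv_lhs => rw [hankelSpace]
    rw [Submodule.span_le]
    rintro _ ⟨⟨v, j⟩, rfl⟩
    refine Submodule.subset_span ⟨(y :: v, j), ?_⟩
    funext ⟨u, i⟩
    simp [σ, LinearMap.funLeft_apply]
  refine ⟨fun y => (σ y).restrict (hσ y),
    fun j => ⟨fun ui => S (ui.1 ++ []) ui.2 j, Submodule.subset_span ⟨([], j), rfl⟩⟩,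
    fun i => LinearMap.proj ([], i) ∘ₗ (hankelSpace S).subtype, ?_⟩
  intro w i j
  have h : ∀ ui : List Y × n, (((w.map fun y => (σ y).restrict (hσ y)).prod
      ⟨fun ui => S (ui.1 ++ []) ui.2 j, Submodule.subset_span ⟨([], j), rfl⟩⟩ : hankelSpace S) :
        List Y × n → F) ui = S (ui.1 ++ w) ui.2 j := by
    induction w with
    | nil => simp
    | cons y w ih =>
      intro ui
      simp only [List.map_cons, List.prod_cons, Module.End.mul_apply, LinearMap.coe_restrict_apply]
      change (Subtype.val _ : List Y × n → F) (ui.1 ++ [y], ui.2) = _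
      rw [ih]
      simp
  exact (h ([], i)).symm

/-- Extension of the state space by zero. -/
theorem Realizes.of_retract {W : Type*} [AddCommGroup W] [Module F W] {A : Y → Module.End F V}
    {b : n → V} {c : n → V →ₗ[F] F} {S : WordSeries (Matrix n n F) Y} (h : Realizes A b c S)
    (f : V →ₗ[F] W) (e : W →ₗ[F] V) (hef : ∀ x, e (f x) = x) :
    Realizes (fun y => f ∘ₗ A y ∘ₗ e) (fun j => f (b j)) (fun i => c i ∘ₗ e) S := by
  intro w i j
  have key : (w.map fun y => (f ∘ₗ A y ∘ₗ e : Module.End F W)).prod (f (b j)) =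
      f ((w.map A).prod (b j)) := by
    induction w with
    | nil => simp
    | cons y w ih => simp [ih, hef]
  simp only [key, LinearMap.comp_apply, hef]
  exact h w i j

/-- A series with a Hankel space of dimension at most `d` is realized on every space of
dimension `d`. -/
theorem exists_realizes_of_finrank_le {W : Type*} [AddCommGroup W] [Module F W]
    [FiniteDimensional F W] {S : WordSeries (Matrix n n F) Y} [FiniteDimensional F (hankelSpace S)]
    (h : Module.finrank F (hankelSpace S) ≤ Module.finrank F W) :
    ∃ (A : Y → Module.End F W) (b : n → W) (c : n → W →ₗ[F] F), Realizes A b c S := by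
  obtain ⟨A, b, c, hS⟩ := exists_realizes_hankelSpace S
  obtain ⟨f, hf⟩ := finrank_le_iff_exists_linearMap.1 h
  obtain ⟨e, he⟩ := f.exists_leftInverse_of_injective (LinearMap.ker_eq_bot.2 hf)
  exact ⟨_, _, _, hS.of_retract f e fun x => LinearMap.congr_fun he x⟩

/-! ### Descriptor systems and translation of their constant term -/

section Descriptor

variable [FiniteDimensional F V] {T T' : Module.End F V} {N : Y → Module.End F V}
  {b : n → V} {c : n → V →ₗ[F] F} {S S' : WordSeries (Matrix n n F) Y}

/-- The series of the descriptor system `c (T + ∑ N_y y)⁻¹ b`. -/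
structure IsDescriptorSeries (T : Module.End F V) (N : Y → Module.End F V) (b : n → V)
    (c : n → V →ₗ[F] F) (S : WordSeries (Matrix n n F) Y) : Prop where
  injective : Function.Injective T
  -- The coefficients of a solution of `(T + ∑ N_y y) x = b`, compared word by word.
  exists_state : ∃ x : List Y → n → V, (∀ j, T (x [] j) = b j) ∧
    (∀ y w j, T (x (y :: w) j) = -N y (x w j)) ∧ ∀ w i j, S w i j = c i (x w j)

/-- In finite dimension `T` is invertible, and the recursion is solved by `A_y = -T⁻¹ N_y` and `b' =
T⁻¹ b`. Both are recorded multiplied by `T`, the form in which two constant terms `T` and `T'` are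
compared. -/
theorem IsDescriptorSeries.exists_realizes (h : IsDescriptorSeries T N b c S) :
    ∃ (A : Y → Module.End F V) (b' : n → V), (∀ y x, T (A y x) = -N y x) ∧
      (∀ j, T (b' j) = b j) ∧ Realizes A b' c S := by
  obtain ⟨hT, x, h1, h2, h3⟩ := h
  let E := LinearEquiv.ofInjectiveEndo T hT
  have hE : ∀ z, T (E.symm z) = z := fun z => E.apply_symm_apply z
  refine ⟨fun y => -(E.symm.toLinearMap ∘ₗ N y), fun j => E.symm (b j), ?_, ?_, ?_⟩
  · intro y x
    simp [hE]
  · intro j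
    simp [hE]
  · intro w i j
    rw [h3]
    congr 1
    induction w with
    | nil => exact hT (by simp [h1, hE])
    | cons y w ih => exact hT (by simp [h2, hE, ← ih])

theorem IsDescriptorSeries.finiteDimensional (h : IsDescriptorSeries T N b c S) :
    FiniteDimensional F (hankelSpace S) := by
  obtain ⟨A, b', -, -, hr⟩ := h.exists_realizes
  exact hr.finiteDimensional

/-- The hypothesis gives `T' U ⊆ T U`, and both sides have the dimension of `U`. -/
theorem map_eq_map_of_invariant [Fintype Y] (δ : Y → F) (hT : Function.Injective T)
    (hT' : Function.Injective T') (hd : T' = T + ∑ y, δ y • N y) {U : Submodule F V}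
    (hU : ∀ y, ∀ x ∈ U, N y x ∈ U.map T) : U.map T = U.map T' := by
  refine (Submodule.eq_of_le_of_finrank_eq ?_ ?_).symm
  · rintro _ ⟨x, hx, rfl⟩
    rw [hd]
    simp only [LinearMap.add_apply, LinearMap.sum_apply, LinearMap.smul_apply]
    exact Submodule.add_mem _ (Submodule.mem_map_of_mem hx)
      (Submodule.sum_mem _ fun y _ => Submodule.smul_mem _ _ (hU y x hx))
  · exact (LinearEquiv.finrank_eq (Submodule.equivMapOfInjective T' hT' U)).symm.trans
      (LinearEquiv.finrank_eq (Submodule.equivMapOfInjective T hT U))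

/-- Invariance under `-T⁻¹ N_y` means `N_y U ⊆ T U`; as `T U = T' U`, it is the same condition for
`T'`. -/
theorem invariant_of_invariant [Fintype Y] (δ : Y → F) (hT : Function.Injective T)
    (hT' : Function.Injective T') (hd : T' = T + ∑ y, δ y • N y) {U : Submodule F V}
    {A A' : Y → Module.End F V} (hA : ∀ y x, T (A y x) = -N y x)
    (hA' : ∀ y x, T' (A' y x) = -N y x) (hU : ∀ y, ∀ x ∈ U, A y x ∈ U) :
    U.map T = U.map T' ∧ ∀ y, ∀ x ∈ U, A' y x ∈ U := by
  have h1 : ∀ y, ∀ x ∈ U, N y x ∈ U.map T := fun y x hx =>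
    ⟨-A y x, Submodule.neg_mem _ (hU y x hx), by simp [hA]⟩
  have h2 := map_eq_map_of_invariant δ hT hT' hd h1
  refine ⟨h2, fun y x hx => ?_⟩
  have h3 : T' (A' y x) ∈ U.map T' := by
    rw [hA', ← h2]
    exact Submodule.neg_mem _ (h1 y x hx)
  obtain ⟨z, hz, hz'⟩ := h3
  rwa [← hT' hz']

theorem reach_le_reach [Fintype Y] (δ : Y → F) (hT : Function.Injective T)
    (hT' : Function.Injective T') (hd : T' = T + ∑ y, δ y • N y)
    {A A' : Y → Module.End F V} {b₁ b₁' : n → V} (hA : ∀ y x, T (A y x) = -N y x)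
    (hA' : ∀ y x, T' (A' y x) = -N y x) (hb : ∀ j, T (b₁ j) = b j) (hb' : ∀ j, T' (b₁' j) = b j) :
    reach A' b₁' ≤ reach A b₁ := by
  obtain ⟨h1, h2⟩ := invariant_of_invariant (U := reach A b₁) δ hT hT' hd hA hA'
    fun y x hx => map_mem_reach y hx
  refine reach_le (fun j => ?_) h2
  have h3 : T' (b₁' j) ∈ (reach A b₁).map T' := by
    rw [← h1, hb', ← hb]
    exact Submodule.mem_map_of_mem (mem_reach A b₁ j)
  obtain ⟨z, hz, hz'⟩ := h3
  rwa [← hT' hz']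

theorem ker_obs_le_ker_obs [Fintype Y] (δ : Y → F) (hT : Function.Injective T)
    (hT' : Function.Injective T') (hd : T' = T + ∑ y, δ y • N y)
    {A A' : Y → Module.End F V} (hA : ∀ y x, T (A y x) = -N y x)
    (hA' : ∀ y x, T' (A' y x) = -N y x) :
    LinearMap.ker (obs A c) ≤ LinearMap.ker (obs A' c) := by
  obtain ⟨-, h2⟩ := invariant_of_invariant (U := LinearMap.ker (obs A c)) δ hT hT' hd hA hA'
    fun y x hx => map_mem_ker_obs y hx
  exact le_ker_obs (fun i x hx => eq_zero_of_mem_ker_obs hx i) h2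

/-- Rank–nullity on `U`. It is needed because the two observability maps share only their kernel, so
the Hankel spaces themselves may differ. -/
theorem finrank_map_congr {W : Type*} [AddCommGroup W] [Module F W] {f f' : V →ₗ[F] W}
    (h : LinearMap.ker f = LinearMap.ker f') (U : Submodule F V) :
    Module.finrank F (U.map f) = Module.finrank F (U.map f') := by
  have h1 := (f.domRestrict U).finrank_range_add_finrank_ker
  have h2 := (f'.domRestrict U).finrank_range_add_finrank_ker
  rw [LinearMap.range_domRestrict, LinearMap.ker_domRestrict] at h1 h2
  rw [h] at h1
  omega

/-- Shifting the constant term of a descriptor system along its letters does not change the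
dimension of the Hankel space. -/
theorem IsDescriptorSeries.finrank_eq [Fintype Y] (h : IsDescriptorSeries T N b c S)
    (h' : IsDescriptorSeries T' N b c S') (δ : Y → F) (hd : T' = T + ∑ y, δ y • N y) :
    Module.finrank F (hankelSpace S) = Module.finrank F (hankelSpace S') := by
  obtain ⟨A, b₁, hA, hb, hr⟩ := h.exists_realizes
  obtain ⟨A', b₁', hA', hb', hr'⟩ := h'.exists_realizes
  have hd' : T = T' + ∑ y, (-δ y) • N y := by
    rw [hd]
    simp
  have h1 : reach A b₁ = reach A' b₁' :=
    (reach_le_reach _ h'.injective h.injective hd' hA' hA hb' hb).antisymm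
      (reach_le_reach δ h.injective h'.injective hd hA hA' hb hb')
  have h2 : LinearMap.ker (obs A c) = LinearMap.ker (obs A' c) :=
    (ker_obs_le_ker_obs δ h.injective h'.injective hd hA hA').antisymm
      (ker_obs_le_ker_obs _ h'.injective h.injective hd' hA' hA)
  rw [hr.hankelSpace_eq, hr'.hankelSpace_eq, h1]
  exact finrank_map_congr h2 _

end Descriptor

end WordSeries

/-! ### Generic matrices centred at a point -/

namespace WordSeries

instance instNeg {R : Type v} [Ring R] {X : Type w} : Neg (WordSeries R X) := ⟨fun S w => -S w⟩

instance instRing {R : Type v} [Ring R] {X : Type w} : Ring (WordSeries R X) where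
  zsmul := zsmulRec
  neg_add_cancel S := ext fun w => neg_add_cancel (S w)

theorem sum_apply {R : Type v} [Semiring R] {X : Type w} {ι : Type*} (s : Finset ι)
    (S : ι → WordSeries R X) (w : List X) : (∑ i ∈ s, S i) w = ∑ i ∈ s, S i w :=
  Finset.sum_apply w s S

variable {F : Type u} [Field F] {g m : ℕ}

/-- The generic `m × m` matrices centred at `p`, as series in their noncommuting entries. -/
def genericPoint (p : Fin g → Matrix (Fin m) (Fin m) F) (k : Fin g) :
    WordSeries (Matrix (Fin m) (Fin m) F) (Fin g × Fin m × Fin m) := fun w =>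
  match w with
  | [] => p k
  | [y] => if y.1 = k then single y.2.1 y.2.2 1 else 0
  | _ :: _ :: _ => 0

theorem genericPoint_mul_nil (p : Fin g → Matrix (Fin m) (Fin m) F) (k : Fin g)
    (S : WordSeries (Matrix (Fin m) (Fin m) F) (Fin g × Fin m × Fin m)) :
    (genericPoint p k * S) [] = p k * S [] :=
  mul_nil _ _

/-- The hypothesis says that `S` has degree at most one, so only prefixes of length 0 and 1
contribute. -/
theorem mul_apply_of_length {R : Type v} [Semiring R] {X : Type w} {S : WordSeries R X}
    (h : ∀ x y w, S (x :: y :: w) = 0) (T : WordSeries R X) (x : X) (w : List X) :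
    (S * T) (x :: w) = S [] * T (x :: w) + S [x] * T w := by
  rw [mul_cons, add_comm]
  congr 1
  cases w with
  | nil => exact mul_nil _ _
  | cons y w =>
    rw [mul_cons]
    have : shift y (shift x S) = 0 := ext fun v => h x y v
    rw [this, zero_mul, zero_apply, zero_add]
    rfl

theorem genericPoint_mul_cons (p : Fin g → Matrix (Fin m) (Fin m) F) (k : Fin g)
    (S : WordSeries (Matrix (Fin m) (Fin m) F) (Fin g × Fin m × Fin m))
    (y : Fin g × Fin m × Fin m) (w : List (Fin g × Fin m × Fin m)) :
    (genericPoint p k * S) (y :: w) =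
      p k * S (y :: w) + if y.1 = k then single y.2.1 y.2.2 1 * S w else 0 := by
  rw [mul_apply_of_length (fun _ _ _ => rfl)]
  simp [genericPoint, ite_mul]

end WordSeries

/-! ### Pencils at generic matrices as descriptor systems -/

namespace LinPencil

variable {F : Type u} [Field F] {g m : ℕ} {ι : Type} [Fintype ι]

theorem atPoint_mulVec {R : Type v} [Ring R] [Algebra F R] (d : LinPencil F g ι) (a : Fin g → R)
    (x : ι → R) (i : ι) :
    (d.atPoint a *ᵥ x) i = ∑ j, (d.L₀ i j • x j + ∑ k, d.L k i j • (a k * x j)) := by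
  simp [mulVec, dotProduct, atPoint, add_mul, Finset.sum_mul, Algebra.smul_def, mul_assoc]

/-- The operator of the pencil at a matrix point, on scalar columns. -/
def op (d : LinPencil F g ι) (p : Fin g → Matrix (Fin m) (Fin m) F) :
    Module.End F (ι × Fin m → F) :=
  Matrix.mulVecLin (Matrix.comp ι ι (Fin m) (Fin m) F (d.atPoint p))

/-- The coefficient of the operator at an entry of the generic matrices. -/
def opCoeff (d : LinPencil F g ι) (y : Fin g × Fin m × Fin m) :
    Module.End F (ι × Fin m → F) :=
  Matrix.mulVecLin (Matrix.comp ι ι (Fin m) (Fin m) F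
    (Matrix.of fun i j => d.L y.1 i j • single y.2.1 y.2.2 1))

/-- A column of `m × m` matrices is a family of `m` scalar columns, indexed by `β`, on each of which
the flattened matrix acts separately. -/
theorem comp_mulVec (M : Matrix ι ι (Matrix (Fin m) (Fin m) F))
    (x : ι → Matrix (Fin m) (Fin m) F) (β : Fin m) :
    (Matrix.comp ι ι (Fin m) (Fin m) F M *ᵥ fun jγ => x jγ.1 jγ.2 β) =
      fun iα => (M *ᵥ x) iα.1 iα.2 β := by
  funext ⟨i, α⟩
  simp [mulVec, dotProduct, Fintype.sum_prod_type, Matrix.sum_apply, Matrix.mul_apply]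

theorem op_injective {d : LinPencil F g ι} {p : Fin g → Matrix (Fin m) (Fin m) F}
    (h : ∀ x : ι → Matrix (Fin m) (Fin m) F, d.atPoint p *ᵥ x = 0 → x = 0) :
    Function.Injective (d.op p) := by
  rw [injective_iff_map_eq_zero]
  intro u hu
  have h1 : (fun j => Matrix.of fun α _ => u (j, α) : ι → Matrix (Fin m) (Fin m) F) = 0 := by
    refine h _ ?_
    funext i
    ext α β
    have := congrFun (comp_mulVec (d.atPoint p) (fun j => Matrix.of fun α _ => u (j, α)) β) (i, α)
    simp only [of_apply] at this
    rw [← this]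
    exact congrFun hu (i, α)
  funext ⟨j, α⟩
  -- All columns of the test matrix equal `u`; the second `α` merely selects one of them.
  exact congrFun (congrFun (congrFun h1 j) α) α

/-- Expanding `q_k - p_k` in matrix units shows that moving the point translates the constant term
along the letter coefficients, as `IsDescriptorSeries.finrank_eq` requires. -/
theorem op_eq_add (d : LinPencil F g ι) (p q : Fin g → Matrix (Fin m) (Fin m) F) :
    d.op q = d.op p + ∑ y : Fin g × Fin m × Fin m,
      (q y.1 - p y.1) y.2.1 y.2.2 • d.opCoeff y := by
  have h : Matrix.comp ι ι (Fin m) (Fin m) F (d.atPoint q) =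
      Matrix.comp ι ι (Fin m) (Fin m) F (d.atPoint p) + ∑ y : Fin g × Fin m × Fin m,
      (q y.1 - p y.1) y.2.1 y.2.2 • Matrix.comp ι ι (Fin m) (Fin m) F
        (Matrix.of fun i j => d.L y.1 i j • single y.2.1 y.2.2 1) := by
    ext ⟨i, α⟩ ⟨j, β⟩
    simp only [atPoint, comp_apply, of_apply, Matrix.add_apply, Matrix.sum_apply, Matrix.smul_apply,
      Fintype.sum_prod_type, single, smul_eq_mul, mul_ite, mul_one, mul_zero, ite_and,
      Matrix.sub_apply]
    simp only [Finset.sum_ite_eq', Finset.mem_univ, if_true, Finset.sum_ite_irrel,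
      Finset.sum_const_zero]
    rw [add_assoc, ← Finset.sum_add_distrib]
    congr 1
    refine Finset.sum_congr rfl fun k _ => ?_
    ring
  ext1 x
  simp only [op, opCoeff, h, LinearMap.add_apply, LinearMap.sum_apply, LinearMap.smul_apply,
    mulVecLin_apply, add_mulVec, sum_mulVec, smul_mulVec]

-- Coefficients are compared in `L(x) X = b` at the generic point: the empty word gives `L(p) X_∅ =
-- b`, the word `y w` gives `L(p) X_{yw} + N_y X_w = 0`. Injectivity is taken from the matrix point.
open WordSeries in
theorem RealizesAt.isDescriptorSeries {d : LinPencil F g ι}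
    {p : Fin g → Matrix (Fin m) (Fin m) F} {v : Matrix (Fin m) (Fin m) F}
    {S : WordSeries (Matrix (Fin m) (Fin m) F) (Fin g × Fin m × Fin m)}
    (hp : d.RealizesAt p v) (h : d.RealizesAt (genericPoint p) S) :
    IsDescriptorSeries (d.op p) d.opCoeff
      (fun β iα => algebraMap F (Matrix (Fin m) (Fin m) F) (d.b iα.1) iα.2 β)
      (fun α => ∑ i, d.c i • LinearMap.proj (i, α)) S := by
  refine ⟨op_injective hp.2, ?_⟩
  obtain ⟨⟨x, hx, hS⟩, -⟩ := h
  have hx' : ∀ i, ∑ j, (d.L₀ i j • x j + ∑ k, d.L k i j • (genericPoint p k * x j)) =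
      d.b i • (1 : WordSeries (Matrix (Fin m) (Fin m) F) (Fin g × Fin m × Fin m)) := by
    intro i
    rw [← atPoint_mulVec, hx]
    exact Algebra.algebraMap_eq_smul_one _
  refine ⟨fun w β jγ => x jγ.1 w jγ.2 β, fun β => ?_, fun y w β => ?_, fun w α β => ?_⟩
  · rw [op, mulVecLin_apply, comp_mulVec _ fun j => x j []]
    funext ⟨i, α⟩
    refine congrFun (congrFun ?_ α) β
    have := congrArg (fun T : WordSeries _ _ => T []) (hx' i)
    simp only [WordSeries.sum_apply, WordSeries.add_apply, WordSeries.smul_apply,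
      genericPoint_mul_nil, one_nil] at this
    rw [atPoint_mulVec, this, Algebra.algebraMap_eq_smul_one]
  · rw [op, opCoeff, mulVecLin_apply, mulVecLin_apply, comp_mulVec _ fun j => x j (y :: w),
      comp_mulVec _ fun j => x j w]
    funext ⟨i, α⟩
    suffices key : (d.atPoint p *ᵥ fun j => x j (y :: w)) i = -((Matrix.of fun i j =>
        d.L y.1 i j • single y.2.1 y.2.2 (1 : F)) *ᵥ fun j => x j w) i from
      congrFun (congrFun key α) β
    have := congrArg (fun T : WordSeries _ _ => T (y :: w)) (hx' i)
    simp only [WordSeries.sum_apply, WordSeries.add_apply, WordSeries.smul_apply,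
      genericPoint_mul_cons, one_cons, smul_zero, smul_add, Finset.sum_add_distrib,
      smul_ite, Finset.sum_ite_eq, Finset.mem_univ, if_true] at this
    rw [atPoint_mulVec, eq_neg_iff_add_eq_zero, ← this]
    simp only [mulVec, dotProduct, of_apply, Finset.sum_add_distrib, add_assoc, smul_mul_assoc]
  · rw [← hS]
    simp [dotProduct, WordSeries.sum_apply, Matrix.sum_apply, Algebra.algebraMap_eq_smul_one,
      WordSeries.smul_apply]

end LinPencil

/-! ### Hankel spaces of one expression at points of one size -/

namespace NCRatExpr

open WordSeries

variable {F : Type u} [Field F] {g m : ℕ}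

/-- The expansion of a rational expression at generic matrices centred at `p`. -/
noncomputable def genericSeries (r : NCRatExpr F g) (p : Fin g → Matrix (Fin m) (Fin m) F) :
    WordSeries (Matrix (Fin m) (Fin m) F) (Fin g × Fin m × Fin m) :=
  r.eval (genericPoint p)

theorem finiteDimensional_hankelSpace {r : NCRatExpr F g}
    {p : Fin g → Matrix (Fin m) (Fin m) F} (hp : r.DefinedAt p)
    (hp' : r.DefinedAt (genericPoint p)) :
    FiniteDimensional F (hankelSpace (r.genericSeries p)) := by
  obtain ⟨ι, _, d, hd⟩ := r.exists_realizesAt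
  exact ((hd _ _ hp).isDescriptorSeries (hd _ _ hp')).finiteDimensional

theorem finrank_hankelSpace_eq {r : NCRatExpr F g}
    {p q : Fin g → Matrix (Fin m) (Fin m) F} (hp : r.DefinedAt p)
    (hp' : r.DefinedAt (genericPoint p)) (hq : r.DefinedAt q)
    (hq' : r.DefinedAt (genericPoint q)) :
    Module.finrank F (hankelSpace (r.genericSeries p)) =
      Module.finrank F (hankelSpace (r.genericSeries q)) := by
  -- A single pencil serves `p`, `q` and both generic points, so the two systems differ only in
  -- their constant terms.
  obtain ⟨ι, _, d, hd⟩ := r.exists_realizesAt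
  exact ((hd _ _ hp).isDescriptorSeries (hd _ _ hp')).finrank_eq
    ((hd _ _ hq).isDescriptorSeries (hd _ _ hq')) _ (d.op_eq_add p q)

end NCRatExpr

namespace WordSeries

/-! ### Ampliations -/

section Ampliation

variable {F : Type u} [Field F] {g m k N : ℕ} (e : Fin m × Fin k ≃ Fin N)

/-- The outer part of an entry of a generic matrix of block matrices. -/
def outerLetter (y : Fin g × Fin N × Fin N) : Fin g × Fin m × Fin m :=
  (y.1, (e.symm y.2.1).1, (e.symm y.2.2).1)

/-- The inner matrix unit of an entry of a generic matrix of block matrices. -/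
def innerUnit (F : Type u) [Field F] (y : Fin g × Fin N × Fin N) : Matrix (Fin k) (Fin k) F :=
  single (e.symm y.2.1).2 (e.symm y.2.2).2 1

/-- The Kronecker product of matrices, indexed through `e`. -/
def kron (a : Matrix (Fin m) (Fin m) F) (b : Matrix (Fin k) (Fin k) F) :
    Matrix (Fin N) (Fin N) F :=
  reindexAlgEquiv F F e (a ⊗ₖ b)

theorem kron_apply (a : Matrix (Fin m) (Fin m) F) (b : Matrix (Fin k) (Fin k) F) (i j : Fin N) :
    kron e a b i j =
      a (e.symm i).1 (e.symm j).1 * b (e.symm i).2 (e.symm j).2 := by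
  simp [kron, kroneckerMap_apply]

theorem kron_mul (a a' : Matrix (Fin m) (Fin m) F) (b b' : Matrix (Fin k) (Fin k) F) :
    kron e (a * a') (b * b') = kron e a b * kron e a' b' := by
  rw [kron, mul_kronecker_mul, map_mul]
  rfl

theorem kron_one : kron e (1 : Matrix (Fin m) (Fin m) F) 1 = 1 := by
  rw [kron, one_kronecker_one, map_one]

/-- The ampliation `a ↦ a ⊗ 1` of matrices. -/
def amplify : Matrix (Fin m) (Fin m) F →ₐ[F] Matrix (Fin N) (Fin N) F :=
  AlgHom.ofLinearMap
    { toFun := fun a => kron e a 1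
      map_add' := fun a b => by ext; simp [kron_apply, add_mul]
      map_smul' := fun α a => by ext; simp [kron_apply, mul_assoc] }
    (kron_one e) (fun a b => by simpa using kron_mul e a b 1 1)

theorem amplify_apply (a : Matrix (Fin m) (Fin m) F) : amplify e a = kron e a 1 := rfl

/-- The ampliation of series. -/
def amplifySeries : WordSeries (Matrix (Fin m) (Fin m) F) (Fin g × Fin m × Fin m) →ₐ[F]
    WordSeries (Matrix (Fin N) (Fin N) F) (Fin g × Fin N × Fin N) :=
  AlgHom.ofLinearMap
    -- An entry of the generic `N × N` matrix lies at an inner position of the block at an outer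
    -- position. Substituting blocks for the entries of the `m × m` matrices therefore multiplies
    -- the inner matrix units along the word.
    { toFun := fun S w => kron e (S (w.map (outerLetter e))) (w.map (innerUnit e F)).prod
      map_add' := fun S T => ext fun w => by
        change kron e (S _ + T _) _ = kron e (S _) _ + kron e (T _) _
        ext; simp [kron_apply, add_mul]
      map_smul' := fun α S => ext fun w => by
        change kron e (α • S _) _ = α • kron e (S _) _
        ext; simp [kron_apply, mul_assoc] }
    (ext fun w => by
      cases w with
      | nil => exact kron_one e
      | cons y w =>
        change kron e 0 _ = 0
        ext; simp [kron_apply])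
    (fun S T => ext fun w => by
      change kron e ((S * T) _) _ = _
      rw [mul_apply, mul_apply, List.length_map]
      have h : ∀ (s : Finset ℕ) (f : ℕ → Matrix (Fin m) (Fin m) F) (b : Matrix (Fin k) (Fin k) F),
          kron e (∑ i ∈ s, f i) b = ∑ i ∈ s, kron e (f i) b := by
        intro s f b
        ext
        simp [kron_apply, Matrix.sum_apply, Finset.sum_mul]
      rw [h]
      refine Finset.sum_congr rfl fun i _ => ?_
      have h2 : (w.map (innerUnit e F)).prod =
          ((w.take i).map (innerUnit e F)).prod * ((w.drop i).map (innerUnit e F)).prod := by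
        rw [← List.prod_append, ← List.map_append, List.take_append_drop]
      rw [h2, kron_mul, ← List.map_take, ← List.map_drop]
      rfl)

theorem amplifySeries_apply (S : WordSeries (Matrix (Fin m) (Fin m) F) (Fin g × Fin m × Fin m))
    (w : List (Fin g × Fin N × Fin N)) :
    amplifySeries e S w = kron e (S (w.map (outerLetter e))) (w.map (innerUnit e F)).prod := rfl

theorem amplifySeries_genericPoint (p : Fin g → Matrix (Fin m) (Fin m) F) (l : Fin g) :
    amplifySeries e (genericPoint p l) = genericPoint (fun l => amplify e (p l)) l := by
  refine ext fun w => ?_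
  rw [amplifySeries_apply]
  match w with
  | [] => rfl
  | [y] =>
    simp only [List.map_cons, List.map_nil, List.prod_cons, List.prod_nil, mul_one, genericPoint,
      outerLetter, innerUnit]
    ext i j
    rw [kron_apply]
    by_cases h : y.1 = l
    · simp only [h, if_true, single_apply, ← ite_and, mul_ite, mul_one, mul_zero]
      congr 1
      rw [← e.symm.injective.eq_iff, ← e.symm.injective.eq_iff (a := y.2.2), Prod.ext_iff,
        Prod.ext_iff]
      exact propext ⟨fun h => ⟨⟨h.2.1, h.1.1⟩, h.2.2, h.1.2⟩, fun h => ⟨⟨h.1.2, h.2.2⟩, h.1.1, h.2.1⟩⟩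
    · simp [h]
  | _ :: _ :: _ =>
    change kron e 0 _ = 0
    ext; simp [kron_apply]

/-- The block diagonal lift of a word. -/
def diagWord (γ : Fin k) (w : List (Fin g × Fin m × Fin m)) : List (Fin g × Fin N × Fin N) :=
  w.map fun y => (y.1, e (y.2.1, γ), e (y.2.2, γ))

theorem map_outerLetter_diagWord (γ : Fin k) (w : List (Fin g × Fin m × Fin m)) :
    (diagWord e γ w).map (outerLetter e) = w := by
  rw [diagWord, List.map_map]
  convert List.map_id w
  funext y
  simp [outerLetter]

/-- The product is `1` for the empty word and `E_γγ` otherwise. These agree in row `γ` and in column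
`γ`, which is all that is used. -/
theorem innerUnit_diagWord_left (γ β : Fin k) (w : List (Fin g × Fin m × Fin m)) :
    ((diagWord e γ w).map (innerUnit e F)).prod γ β = if γ = β then 1 else 0 := by
  induction w with
  | nil => simp [diagWord, one_apply]
  | cons y w ih =>
    simp only [diagWord, List.map_cons, List.prod_cons] at ih ⊢
    simpa [innerUnit] using ih

theorem innerUnit_diagWord_right (γ α : Fin k) (w : List (Fin g × Fin m × Fin m)) :
    ((diagWord e γ w).map (innerUnit e F)).prod α γ = if α = γ then 1 else 0 := by
  cases w with
  | nil => simp [diagWord, one_apply]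
  | cons y w =>
    have ih := innerUnit_diagWord_left (F := F) e γ γ w
    simp only [diagWord, List.map_cons, List.prod_cons] at ih ⊢
    by_cases h : α = γ
    · subst h
      simpa [innerUnit] using ih
    · simp [innerUnit, h, single_mul_apply_of_ne]

/-- The embedding of tuples of Hankel columns into the columns of the ampliation. -/
def amplifyHankel : (Fin k → List (Fin g × Fin m × Fin m) × Fin m → F) →ₗ[F]
    (List (Fin g × Fin N × Fin N) × Fin N → F) where
  toFun f ui := ∑ γ, (ui.1.map (innerUnit e F)).prod (e.symm ui.2).2 γ *
    f γ (ui.1.map (outerLetter e), (e.symm ui.2).1)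
  map_add' f f' := by
    funext ui
    simp [mul_add, Finset.sum_add_distrib]
  map_smul' α f := by
    funext ui
    simp [Finset.mul_sum, mul_left_comm]

theorem amplifyHankel_apply (f : Fin k → List (Fin g × Fin m × Fin m) × Fin m → F)
    (u : List (Fin g × Fin N × Fin N)) (i : Fin N) :
    amplifyHankel e f (u, i) = ∑ γ, (u.map (innerUnit e F)).prod (e.symm i).2 γ *
      f γ (u.map (outerLetter e), (e.symm i).1) := rfl

/-- The rows at the diagonal words of `γ` return the component `f γ`. -/
theorem amplifyHankel_injective :
    Function.Injective (amplifyHankel (F := F) (g := g) e) := by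
  rw [injective_iff_map_eq_zero]
  intro f hf
  funext γ ⟨u, a⟩
  have := congrFun hf (diagWord e γ u, e (a, γ))
  simpa [amplifyHankel_apply, map_outerLetter_diagWord, innerUnit_diagWord_left, ite_mul] using this

/-- The Hankel space of an ampliation has the `k`-fold dimension. -/
theorem finrank_hankelSpace_amplifySeries
    (S : WordSeries (Matrix (Fin m) (Fin m) F) (Fin g × Fin m × Fin m))
    [FiniteDimensional F (hankelSpace S)] :
    Module.finrank F (hankelSpace (amplifySeries e S)) =
      k * Module.finrank F (hankelSpace S) := by
  let J : (Fin k → hankelSpace S) →ₗ[F] (List (Fin g × Fin N × Fin N) × Fin N → F) :=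
    amplifyHankel e ∘ₗ (hankelSpace S).subtype.compLeft (Fin k)
  have hJ : Function.Injective J :=
    (amplifyHankel_injective e).comp fun f f' h => funext fun γ => Subtype.ext (congrFun h γ)
  have hrange : hankelSpace (amplifySeries e S) = LinearMap.range J := by
    apply le_antisymm
    · rw [hankelSpace, Submodule.span_le]
      rintro _ ⟨⟨v, j⟩, rfl⟩
      -- Writing the inner product of `u v` as a matrix product over `γ` splits off the factor
      -- belonging to `u`; the factor of `v` supplies the scalars.
      refine ⟨fun γ => (v.map (innerUnit e F)).prod γ (e.symm j).2 •
        ⟨_, Submodule.subset_span ⟨(v.map (outerLetter e), (e.symm j).1), rfl⟩⟩, ?_⟩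
      funext ⟨u, i⟩
      simp only [J, LinearMap.comp_apply, amplifyHankel_apply, amplifySeries_apply, kron_apply,
        List.map_append, List.prod_append, Matrix.mul_apply, Finset.mul_sum]
      refine Finset.sum_congr rfl fun γ _ => ?_
      simp
      ring
    · rintro _ ⟨f, rfl⟩
      have h1 : f = ∑ γ, Pi.single γ (f γ) := (Finset.univ_sum_single f).symm
      rw [h1, map_sum]
      refine Submodule.sum_mem _ fun γ _ => ?_
      suffices h : hankelSpace S ≤ (hankelSpace (amplifySeries e S)).comap
          (amplifyHankel e ∘ₗ LinearMap.single F _ γ) by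
        have h2 := h (f γ).2
        rw [Submodule.mem_comap, LinearMap.comp_apply] at h2
        have h3 : (hankelSpace S).subtype.compLeft (Fin k) (Pi.single γ (f γ)) =
            LinearMap.single F (fun _ => List (Fin g × Fin m × Fin m) × Fin m → F) γ (f γ) := by
          funext γ'
          by_cases hγ : γ' = γ
          · subst hγ; simp
          · simp [hγ]
        rwa [← h3] at h2
      conv_lhs => rw [hankelSpace]
      rw [Submodule.span_le]
      rintro _ ⟨⟨v, b⟩, rfl⟩
      -- A Hankel column of `S` placed in slot `γ` is the column of the ampliation at the diagonal
      -- word.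
      refine Submodule.subset_span ⟨(diagWord e γ v, e (b, γ)), ?_⟩
      funext ⟨u, i⟩
      simp only [LinearMap.comp_apply, amplifyHankel_apply, amplifySeries_apply, kron_apply,
        List.map_append, List.prod_append, Matrix.mul_apply, map_outerLetter_diagWord,
        Equiv.symm_apply_apply, innerUnit_diagWord_right, LinearMap.coe_single]
      rw [Finset.sum_eq_single γ, Finset.sum_eq_single γ]
      · simp [mul_comm]
      · intro γ' _ h; simp [h]
      · simp
      · intro γ' _ h; simp [h]
      · simp
  rw [hrange, LinearMap.finrank_range_of_inj hJ, Module.finrank_pi_fintype]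
  simp

end Ampliation

/-! ### Detecting coefficients by block triangular matrices -/

section Triangular

variable {F : Type u} [Field F] {A : Type v} [Ring A] [Algebra F A] {X : Type w}

theorem take_drop_take {w : List X} {i t j : ℕ} (h : i + t ≤ j) :
    ((w.take j).drop i).take t = (w.take (i + t)).drop i := by
  rw [List.take_drop, List.take_take, min_eq_left h]

/-- The block upper triangular matrix of the coefficients at the subwords of `w`. -/
def triangular (w : List X) :
    WordSeries A X →ₐ[F] Matrix (Fin (w.length + 1)) (Fin (w.length + 1)) A :=
  AlgHom.ofLinearMap
    { toFun := fun S => Matrix.of fun i j =>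
        if (i : ℕ) ≤ j then S ((w.take j).drop i) else 0
      map_add' := fun S T => by
        ext i j
        simp only [of_apply, Matrix.add_apply]
        split_ifs
        · rfl
        · simp
      map_smul' := fun α S => by
        ext i j
        simp only [of_apply, Matrix.smul_apply]
        split_ifs
        · rfl
        · simp }
    (by
      ext i j
      simp only [LinearMap.coe_mk, AddHom.coe_mk, of_apply]
      by_cases hij : i = j
      · subst hij
        have : (w.take i).drop i = [] := by simp
        rw [if_pos le_rfl, one_apply_eq, this, one_nil]
      · rw [one_apply_ne hij]
        by_cases h : (i : ℕ) ≤ j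
        · rw [if_pos h]
          have h1 : (i : ℕ) < j := lt_of_le_of_ne h fun h => hij (Fin.ext h)
          have h2 := j.2
          cases hw : (w.take j).drop i with
          | nil =>
            have := congrArg List.length hw
            simp at this
            omega
          | cons x v => exact one_cons x v
        · rw [if_neg h])
    -- The subword between positions `i` and `j` is cut at each `l` with `i ≤ l ≤ j`, so the matrix
    -- product is the convolution after the substitution `l = i + t`.
    (fun S T => by
      ext i j
      simp only [LinearMap.coe_mk, AddHom.coe_mk, of_apply, Matrix.mul_apply]
      rw [← Fin.sum_univ_eq_sum_range (n := w.length + 1) (fun l =>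
        (if (i : ℕ) ≤ l then S ((w.take l).drop i) else 0) *
          (if l ≤ (j : ℕ) then T ((w.take j).drop l) else 0)) |>.symm]
      have hj := j.2
      by_cases h : (i : ℕ) ≤ j
      · rw [if_pos h, mul_apply]
        have hlen : ((w.take j).drop i).length + 1 = j + 1 - i := by
          simp
          omega
        have hsub : Finset.Ico (i : ℕ) (j + 1) ⊆ Finset.range (w.length + 1) := by
          intro l hl
          simp at hl ⊢
          omega
        rw [← Finset.sum_subset hsub, Finset.sum_Ico_eq_sum_range, hlen]
        · refine Finset.sum_congr rfl fun t ht => ?_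
          have ht' : (i : ℕ) + t ≤ j := by
            simp at ht
            omega
          rw [if_pos (Nat.le_add_right _ _), if_pos ht', take_drop_take ht', List.drop_drop]
        · intro l _ hl
          by_cases h1 : (i : ℕ) ≤ l
          · have h2 : ¬ l ≤ (j : ℕ) := by
              simp at hl
              omega
            simp [h2]
          · simp [h1]
      · rw [if_neg h]
        refine (Finset.sum_eq_zero fun l _ => ?_).symm
        by_cases h1 : (i : ℕ) ≤ l
        · have h2 : ¬ l ≤ (j : ℕ) := by omega
          simp [h2]
        · simp [h1])

theorem triangular_zero_last (w : List X) (S : WordSeries A X) :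
    triangular (F := F) w S 0 (Fin.last _) = S w := by
  simp [triangular]

end Triangular

end WordSeries

namespace NCRatExpr

open WordSeries

variable {F : Type u} [Field F] {g : ℕ}

/-- Expressions that agree have the same expansions. -/
theorem Agree.genericSeries_eq {r s : NCRatExpr F g} (h : r.Agree s) {N : ℕ} (hN : 0 < N)
    {a : Fin g → Matrix (Fin N) (Fin N) F} (hr : r.DefinedAt (genericPoint a))
    (hs : s.DefinedAt (genericPoint a)) : r.genericSeries a = s.genericSeries a := by
  refine WordSeries.ext fun w => ?_
  let E := reindexAlgEquiv F F (finProdFinEquiv (m := w.length + 1) (n := N))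
  let E' := compAlgEquiv (Fin (w.length + 1)) (Fin N) F F
  -- The triangular matrices have entries in `M_N(F)`; flattened, they are scalar matrices of size
  -- `(|w| + 1) N`, where agreement of the expressions applies.
  let φ : WordSeries (Matrix (Fin N) (Fin N) F) (Fin g × Fin N × Fin N) →ₐ[F]
      Matrix (Fin ((w.length + 1) * N)) (Fin ((w.length + 1) * N)) F :=
    (E.toAlgHom.comp E'.toAlgHom).comp (triangular w)
  have h1 := definedAt_map φ hr
  have h2 := definedAt_map φ hs
  have h3 := h _ (Nat.mul_pos w.length.succ_pos hN) _ ⟨h1.1, h2.1⟩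
  have hφ : ∀ T, φ T = E (E' (triangular (F := F) w T)) := fun T => rfl
  rw [h1.2, h2.2, hφ, hφ] at h3
  have h4 := E'.injective (E.injective h3)
  have h5 := congrFun (congrFun h4 0) (Fin.last _)
  exact (triangular_zero_last w _).symm.trans (h5.trans (triangular_zero_last w _))

end NCRatExpr

/-! ## Generic definedness along lines and transitivity of the agreement of expressions -/

namespace NCRatExpr

open Polynomial

variable {F : Type u} [Field F] {g N : ℕ}

/-- Along a line through a point of its domain, a rational expression is defined off the zeros of
a polynomial, and given there by polynomial matrices with a common denominator. -/
theorem exists_polynomial_eval_line {r : NCRatExpr F g} {a δ : Fin g → Matrix (Fin N) (Fin N) F}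
    {t₀ : F} (h : r.DefinedAt (fun k => a k + t₀ • δ k)) :
    ∃ (d : F[X]) (P : Matrix (Fin N) (Fin N) F[X]), d.eval t₀ ≠ 0 ∧ ∀ t, d.eval t ≠ 0 →
      r.DefinedAt (fun k => a k + t • δ k) ∧
        d.eval t • r.eval (fun k => a k + t • δ k) = P.map (Polynomial.eval t) := by
  induction r with
  | poly f =>
    refine ⟨1, FreeAlgebra.lift F (fun k => (a k).map C + (X : F[X]) • (δ k).map C) f, by simp,
      fun t _ => ⟨trivial, ?_⟩⟩
    have key : FreeAlgebra.lift F (fun k => a k + t • δ k) = ((Polynomial.aeval t).mapMatrix :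
        Matrix (Fin N) (Fin N) F[X] →ₐ[F] _).comp
          (FreeAlgebra.lift F (fun k => (a k).map C + (X : F[X]) • (δ k).map C)) := by
      ext k i j
      simp
      ring
    rw [NCRatExpr.eval, key, eval_one, one_smul]
    rfl
  | add r s hr hs =>
    obtain ⟨d, P, hd, h1⟩ := hr h.1
    obtain ⟨e, Q, he, h2⟩ := hs h.2
    refine ⟨d * e, e • P + d • Q, by simp [hd, he], fun t ht => ?_⟩
    rw [eval_mul] at ht
    obtain ⟨h3, h4⟩ := h1 t (left_ne_zero_of_mul ht)
    obtain ⟨h5, h6⟩ := h2 t (right_ne_zero_of_mul ht)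
    refine ⟨⟨h3, h5⟩, ?_⟩
    have h7 : (e • P + d • Q).map (Polynomial.eval t) =
        e.eval t • P.map (Polynomial.eval t) + d.eval t • Q.map (Polynomial.eval t) := by
      ext i j
      simp
    rw [h7, ← h4, ← h6, NCRatExpr.eval, eval_mul, smul_add, smul_smul, smul_smul, mul_comm]
  | mul r s hr hs =>
    obtain ⟨d, P, hd, h1⟩ := hr h.1
    obtain ⟨e, Q, he, h2⟩ := hs h.2
    refine ⟨d * e, P * Q, by simp [hd, he], fun t ht => ?_⟩
    rw [eval_mul] at ht
    obtain ⟨h3, h4⟩ := h1 t (left_ne_zero_of_mul ht)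
    obtain ⟨h5, h6⟩ := h2 t (right_ne_zero_of_mul ht)
    refine ⟨⟨h3, h5⟩, ?_⟩
    have h7 : (P * Q).map (Polynomial.eval t) =
        P.map (Polynomial.eval t) * Q.map (Polynomial.eval t) :=
      Matrix.map_mul (f := Polynomial.evalRingHom t)
    rw [h7, ← h4, ← h6, NCRatExpr.eval, eval_mul, smul_mul_smul_comm]
  | inv r hr =>
    obtain ⟨d, P, hd, h1⟩ := hr h.1
    have hdet : ∀ t, (P.map (Polynomial.eval t)).det = P.det.eval t := fun t =>
      (RingHom.map_det (Polynomial.evalRingHom t) P).symm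
    -- From `d M = P` one gets `M⁻¹ = d P⁻¹ = d adj(P) / det P`; clearing the denominator `d det P`
    -- leaves `d² adj(P)`.
    refine ⟨d * P.det, (d * d) • P.adjugate, ?_, fun t ht => ?_⟩
    · rw [eval_mul, ← hdet, ← (h1 t₀ hd).2, det_smul]
      exact mul_ne_zero hd (mul_ne_zero (pow_ne_zero _ hd)
        ((Matrix.isUnit_iff_isUnit_det _).1 h.2).ne_zero)
    · rw [eval_mul] at ht
      have hdt := left_ne_zero_of_mul ht
      obtain ⟨h3, h4⟩ := h1 t hdt
      set M := r.eval (fun k => a k + t • δ k) with hM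
      have h5 : P.det.eval t = d.eval t ^ N * M.det := by
        rw [← hdet, ← h4, det_smul, Fintype.card_fin]
      have h6 : M.det ≠ 0 := right_ne_zero_of_mul (h5 ▸ right_ne_zero_of_mul ht)
      have h7 : IsUnit M := (Matrix.isUnit_iff_isUnit_det _).2 h6.isUnit
      refine ⟨⟨h3, h7⟩, ?_⟩
      have h8 : ((d * d) • P.adjugate).map (Polynomial.eval t) =
          (d.eval t * d.eval t) • (P.map (Polynomial.eval t)).adjugate := by
        have := RingHom.map_adjugate (Polynomial.evalRingHom t) P
        rw [RingHom.mapMatrix_apply, RingHom.mapMatrix_apply] at this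
        change _ = (d.eval t * d.eval t) • (P.map (Polynomial.evalRingHom t)).adjugate
        rw [← this]
        ext i j
        simp
      rw [h8, NCRatExpr.eval, ← hM, ← Matrix.nonsing_inv_eq_ringInverse]
      refine (Matrix.isUnit_iff_isUnit_det _).1 h7 |> fun hu => ?_
      have h9 : ((d * P.det).eval t • M⁻¹) * M =
          ((d.eval t * d.eval t) • (P.map (Polynomial.eval t)).adjugate) * M := by
        rw [smul_mul_assoc, Matrix.nonsing_inv_mul M hu, smul_mul_assoc, mul_smul,
          ← mul_smul_comm (d.eval t), h4, adjugate_mul, hdet, smul_smul, eval_mul]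
      exact h7.mul_right_cancel h9

variable [Infinite F]

/-- Two nonzero polynomials have a common point where neither vanishes. -/
theorem exists_eval_ne_zero {d e : F[X]} {s t : F} (hd : d.eval s ≠ 0) (he : e.eval t ≠ 0) :
    ∃ x, d.eval x ≠ 0 ∧ e.eval x ≠ 0 := by
  have hd' : d ≠ 0 := by rintro rfl; simp at hd
  have he' : e ≠ 0 := by rintro rfl; simp at he
  by_contra! h
  refine mul_ne_zero hd' he' (Polynomial.funext fun x => ?_)
  rw [eval_mul, eval_zero]
  by_cases hx : d.eval x = 0
  · rw [hx, zero_mul]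
  · rw [h x hx, mul_zero]

/-- Two rational expressions with points of the same size in their domains are simultaneously
defined somewhere. -/
theorem exists_definedAt_both {r s : NCRatExpr F g} {a b : Fin g → Matrix (Fin N) (Fin N) F}
    (hr : r.DefinedAt a) (hs : s.DefinedAt b) :
    ∃ c : Fin g → Matrix (Fin N) (Fin N) F, r.DefinedAt c ∧ s.DefinedAt c := by
  -- The line from `a` to `b` meets the domain of `r` at parameter 0 and that of `s` at parameter 1.
  obtain ⟨d, P, hd, h1⟩ := exists_polynomial_eval_line (a := a) (δ := fun k => b k - a k)
    (t₀ := 0) (by simpa using hr)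
  obtain ⟨e, Q, he, h2⟩ := exists_polynomial_eval_line (a := a) (δ := fun k => b k - a k)
    (t₀ := 1) (by simpa using hs)
  obtain ⟨x, hx1, hx2⟩ := exists_eval_ne_zero hd he
  exact ⟨_, (h1 x hx1).1, (h2 x hx2).1⟩

/-- Agreement at a point follows from agreement with a third expression defined at some point of
the same size. -/
theorem eval_eq_of_agree {r s t : NCRatExpr F g} (hrs : r.Agree s) (hst : s.Agree t) (hN : 0 < N)
    {a b : Fin g → Matrix (Fin N) (Fin N) F} (hr : r.DefinedAt a) (ht : t.DefinedAt a)
    (hs : s.DefinedAt b) : r.eval a = t.eval a := by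
  obtain ⟨d, P, hd, h1⟩ := exists_polynomial_eval_line (a := a) (δ := fun k => b k - a k)
    (t₀ := 0) (by simpa using hr)
  obtain ⟨e, Q, he, h2⟩ := exists_polynomial_eval_line (a := a) (δ := fun k => b k - a k)
    (t₀ := 0) (by simpa using ht)
  obtain ⟨f, R, hf, h3⟩ := exists_polynomial_eval_line (a := a) (δ := fun k => b k - a k)
    (t₀ := 1) (by simpa using hs)
  have hf' : f ≠ 0 := by rintro rfl; simp at hf
  -- Where `d`, `e`, `f` are all nonzero, `s` mediates between `r` and `t`, whence `e P = d Q`. The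
  -- factor `d e f` disposes of the remaining parameters and is cancelled as a nonzero polynomial.
  have h4 : ∀ i j, d * e * f * (e * P i j - d * Q i j) = 0 := by
    intro i j
    refine Polynomial.funext fun x => ?_
    simp only [eval_mul, eval_sub, eval_zero]
    by_cases hx : d.eval x = 0 ∨ e.eval x = 0 ∨ f.eval x = 0
    · rcases hx with hx | hx | hx <;> simp [hx]
    · push Not at hx
      obtain ⟨h5, h6⟩ := h1 x hx.1
      obtain ⟨h7, h8⟩ := h2 x hx.2.1
      obtain ⟨h9, -⟩ := h3 x hx.2.2
      have h10 := (hrs N hN _ ⟨h5, h9⟩).trans (hst N hN _ ⟨h9, h7⟩)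
      rw [h10] at h6
      have h11 := congrFun (congrFun h6 i) j
      have h12 := congrFun (congrFun h8 i) j
      simp only [Matrix.smul_apply, Matrix.map_apply, smul_eq_mul] at h11 h12
      rw [← h11, ← h12]
      ring
  have hd' : d ≠ 0 := by rintro rfl; simp at hd
  have he' : e ≠ 0 := by rintro rfl; simp at he
  obtain ⟨-, h6⟩ := h1 0 hd
  obtain ⟨-, h8⟩ := h2 0 he
  simp only [zero_smul, add_zero] at h6 h8
  ext i j
  have h13 := (mul_eq_zero.1 (h4 i j)).resolve_left (mul_ne_zero (mul_ne_zero hd' he') hf')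
  have h14 := congrArg (Polynomial.eval 0) h13
  have h11 := congrFun (congrFun h6 i) j
  have h12 := congrFun (congrFun h8 i) j
  simp only [Matrix.smul_apply, Matrix.map_apply, smul_eq_mul] at h11 h12
  rw [eval_sub, eval_mul, eval_mul, ← h11, ← h12, eval_zero] at h14
  refine mul_left_cancel₀ (mul_ne_zero hd he) ?_
  linear_combination h14

-- The middle expression may be undefined at every point of size `m`. Ampliating `a` by `k` and `b`
-- by `m` brings both to size `m k`, and the values at `a` are read off from one diagonal position
-- of the inner factor.
open WordSeries in
theorem Agree.trans {r s t : NCRatExpr F g} (hrs : r.Agree s) (hst : s.Agree t)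
    (hs : s.Nondegenerate) : r.Agree t := by
  rintro m hm a ⟨hr, ht⟩
  obtain ⟨k, hk, b, hb⟩ := hs
  have h1 := definedAt_map (amplify (F := F) (finProdFinEquiv (m := m) (n := k))) hr
  have h2 := definedAt_map (amplify (F := F) (finProdFinEquiv (m := m) (n := k))) ht
  have h3 := definedAt_map (amplify (F := F) ((Equiv.prodComm _ _).trans
    (finProdFinEquiv (m := m) (n := k)))) hb
  have h4 := eval_eq_of_agree hrs hst (Nat.mul_pos hm hk) h1.1 h2.1 h3.1
  rw [h1.2, h2.2] at h4
  ext i j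
  have h5 := congrFun (congrFun h4 (finProdFinEquiv (i, (⟨0, hk⟩ : Fin k))))
    (finProdFinEquiv (j, (⟨0, hk⟩ : Fin k)))
  simpa [amplify_apply, kron_apply, one_apply] using h5

/-- `Quot` identifies along the generated equivalence relation; only because agreement already is
one do equal classes yield agreeing representatives. -/
theorem agree_equivalence :
    Equivalence fun r s : {r : NCRatExpr F g // r.Nondegenerate} => r.1.Agree s.1 where
  refl _ _ _ _ _ := rfl
  symm h m hm a ha := (h m hm a ⟨ha.2, ha.1⟩).symm
  trans {_ s _} h h' := h.trans h' s.2

end NCRatExpr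

/-- Representatives of the same rational function agree. -/
theorem NCRatFun.IsRepresentedBy.agree {F : Type u} [Field F] [Infinite F] {g : ℕ}
    {f : NCRatFun F g} {r s : NCRatExpr F g} (hr : f.IsRepresentedBy r)
    (hs : f.IsRepresentedBy s) : r.Agree s := by
  obtain ⟨h1, h2⟩ := hr
  obtain ⟨h3, h4⟩ := hs
  exact (NCRatExpr.agree_equivalence.eqvGen_iff).1 (Quot.eqvGen_exact (h2.symm.trans h4))

/-! ## Generalized series over matrices as matrix valued series -/

namespace WordSeries

variable {F : Type u} [Field F] {R : Type v} [Semiring R] [Algebra F R] {X : Type w}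

/-- The constant series. -/
def const (a : R) : WordSeries R X := fun w =>
  match w with
  | [] => a
  | _ :: _ => 0

theorem const_nil (a : R) : (const a : WordSeries R X) [] = a := rfl

theorem const_cons (a : R) (x : X) (w : List X) : (const a : WordSeries R X) (x :: w) = 0 := rfl

theorem const_mul_apply (a : R) (S : WordSeries R X) (w : List X) :
    ((const a : WordSeries R X) * S) w = a * S w := by
  cases w with
  | nil => exact mul_nil _ _
  | cons x w =>
    rw [mul_apply_of_length (fun _ _ _ => rfl), const_nil, const_cons, zero_mul, add_zero]

/-- The embedding of the constants. -/
def constHom (F : Type u) [Field F] (R : Type v) [Semiring R] [Algebra F R] (X : Type w) :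
    R →ₐ[F] WordSeries R X :=
  AlgHom.ofLinearMap
    { toFun := const
      map_add' := fun a b => ext fun w => by
        cases w with
        | nil => rfl
        | cons x w => exact (add_zero (0 : R)).symm
      map_smul' := fun α a => ext fun w => by
        cases w with
        | nil => rfl
        | cons x w => exact (smul_zero (A := R) α).symm }
    (ext fun w => by cases w <;> rfl)
    (fun a b => ext fun w => by
      change (const (a * b) : WordSeries R X) w = (const a * const b : WordSeries R X) w
      rw [const_mul_apply]
      cases w with
      | nil => rfl
      | cons x w => exact (mul_zero a).symm)

/-- The constant term. -/
def constTerm (F : Type u) [Field F] (R : Type v) [Semiring R] [Algebra F R] (X : Type w) :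
    WordSeries R X →ₐ[F] R :=
  AlgHom.ofLinearMap
    { toFun := fun S => S []
      map_add' := fun _ _ => rfl
      map_smul' := fun _ _ => rfl }
    rfl (fun S T => mul_nil S T)

/-- The coefficients of a right inverse of a series whose constant term has right inverse `u`. -/
def rightInv (F : Type u) [Field F] {R : Type v} [Semiring R] [Algebra F R] {X : Type w} (u : R) (S : WordSeries R X) : List X → R
  | [] => u
  | x :: w => (-1 : F) • (u * ∑ i ∈ Finset.range (w.length + 1),
      S (x :: w.take i) * rightInv F u S (w.drop i))
  termination_by w => w.length
  decreasing_by simp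

theorem mul_rightInv {u : R} {S : WordSeries R X} (h : S [] * u = 1) :
    S * (show WordSeries R X from rightInv F u S) = 1 := by
  refine ext fun w => ?_
  cases w with
  | nil =>
    rw [mul_nil, one_nil]
    rwa [rightInv]
  | cons x w =>
    rw [mul_cons, one_cons]
    rw [rightInv, mul_smul_comm, ← mul_assoc, h, one_mul, mul_apply]
    change (∑ i ∈ Finset.range (w.length + 1), S (x :: w.take i) * rightInv F u S (w.drop i)) + _ = 0
    -- `R` is only a semiring; additive inverses come from the scalar `-1` of `F`.
    have h2 : ∀ z : R, z + (-1 : F) • z = 0 := fun z => by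
      conv_lhs => rw [← one_smul F z, smul_smul, ← add_smul]
      simp
    exact h2 _

end WordSeries

namespace GenPoly

variable (F : Type u) [Field F] (A : Type u) [Ring A] [Algebra F A] (g : ℕ)

theorem mul_mem_wordBimod {u v : List (Fin g)} {x y : GenPoly F A g} (hx : x ∈ wordBimod F A g u)
    (hy : y ∈ wordBimod F A g v) : x * y ∈ wordBimod F A g (u ++ v) :=
  wordBimod_mul_le F A g u v (Submodule.mul_mem_mul hx hy)

theorem C_mem_wordBimod (a : A) : C F A g a ∈ wordBimod F A g [] := ⟨a, rfl⟩

theorem C_mul_mem_wordBimod (a : A) {v : List (Fin g)} {y : GenPoly F A g}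
    (hy : y ∈ wordBimod F A g v) : C F A g a * y ∈ wordBimod F A g v :=
  mul_mem_wordBimod F A g (C_mem_wordBimod F A g a) hy

variable {F A g} in
theorem letterBimod_induction {k : Fin g} {P : GenPoly F A g → Prop}
    (basic : ∀ a b, P (C F A g a * X F A g k * C F A g b)) (add : ∀ x y, P x → P y → P (x + y))
    {x : GenPoly F A g} (hx : x ∈ letterBimod F A g k) : P x := by
  rw [letterBimod] at hx
  refine Submodule.mul_induction_on hx (fun y hy z hz => ?_) add
  obtain ⟨b, rfl⟩ := hz
  refine Submodule.mul_induction_on hy (fun y hy z hz => ?_) fun y z h1 h2 => ?_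
  · obtain ⟨a, rfl⟩ := hy
    obtain ⟨α, rfl⟩ := Submodule.mem_span_singleton.1 hz
    have : C F A g a * (α • X F A g k) = C F A g (α • a) * X F A g k := by
      rw [map_smul, mul_smul_comm, smul_mul_assoc]
    change P (C F A g a * (α • X F A g k) * C F A g b)
    rw [this]
    exact basic _ _
  · rw [add_mul]
    exact add _ _ h1 h2

theorem C_mul_X_mul_C_mem (k : Fin g) (a b : A) :
    C F A g a * X F A g k * C F A g b ∈ letterBimod F A g k :=
  Submodule.mul_mem_mul (Submodule.mul_mem_mul ⟨a, rfl⟩ (Submodule.mem_span_singleton_self _))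
    ⟨b, rfl⟩

end GenPoly

namespace GenSeries

variable {F : Type u} [Field F] {A : Type u} [Ring A] [Algebra F A] {g : ℕ}

theorem exists_mul_eq_one {S : GenSeries F A g} {a b : A} (hS : S.1 [] = GenPoly.C F A g a)
    (hab : a * b = 1) : ∃ T : GenSeries F A g, S * T = 1 ∧ T.1 [] = GenPoly.C F A g b := by
  have h1 : S.1 [] * GenPoly.C F A g b = 1 := by rw [hS, ← map_mul, hab, map_one]
  refine ⟨⟨WordSeries.rightInv F (GenPoly.C F A g b) S.1, fun w => ?_⟩,
    Subtype.ext (WordSeries.mul_rightInv h1), ?_⟩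
  · induction hn : w.length using Nat.strong_induction_on generalizing w with
    | _ n ih =>
      cases w with
      | nil =>
        rw [WordSeries.rightInv]
        exact GenPoly.C_mem_wordBimod F A g b
      | cons x w =>
        rw [WordSeries.rightInv]
        refine Submodule.smul_mem _ _ (GenPoly.C_mul_mem_wordBimod F A g b
          (Submodule.sum_mem _ fun i _ => ?_))
        have h2 := GenPoly.mul_mem_wordBimod F A g (S.2 (x :: w.take i))
          (ih (w.drop i).length (by subst hn; simp) (w.drop i) rfl)
        rwa [List.cons_append, List.take_append_drop] at h2
  · change WordSeries.rightInv F (GenPoly.C F A g b) S.1 [] = _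
    rw [WordSeries.rightInv]

/-- The right inverse `T` has an invertible constant term, hence a right inverse `U` of its own, and
associativity forces `U = S`. -/
theorem isUnit_of_constTerm {S : GenSeries F A g} {a : A} (hS : S.1 [] = GenPoly.C F A g a)
    (ha : IsUnit a) : IsUnit S := by
  obtain ⟨u, rfl⟩ := ha
  obtain ⟨T, hT, hT'⟩ := exists_mul_eq_one hS u.mul_inv
  obtain ⟨U, hU, -⟩ := exists_mul_eq_one hT' u.inv_mul
  have : U = S := by rw [← one_mul U, ← hT, mul_assoc, hU, mul_one]
  exact ⟨⟨S, T, hT, this ▸ hU⟩, rfl⟩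

end GenSeries

namespace NCRatExpr

variable {F : Type u} [Field F] {A : Type u} [Ring A] [Algebra F A] {g : ℕ}

/-- The expansion of an expression about a point of its domain is defined. -/
theorem definedAt_letterAdd {r : NCRatExpr F g} {p : Fin g → A} (h : r.DefinedAt p) :
    r.DefinedAt (fun k => GenSeries.letterAdd F A g k (p k)) := by
  -- Taking constant terms of the series and embedding `A` by `C` both send the relevant tuples to
  -- `C (p_k)`, so the constant term of an expansion is the value at `p`.
  have key : ∀ s : NCRatExpr F g, s.DefinedAt p →
      s.DefinedAt (fun k => GenSeries.letterAdd F A g k (p k)) →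
      (s.expansion p).1 [] = GenPoly.C F A g (s.eval p) := by
    intro s h1 h2
    have h3 := definedAt_map ((WordSeries.constTerm F (GenPoly F A g) (Fin g)).comp
      (GenSeries F A g).val) h2
    have h4 := definedAt_map (GenPoly.C F A g) h1
    exact h3.2.symm.trans h4.2
  induction r with
  | poly f => trivial
  | add r s hr hs => exact ⟨hr h.1, hs h.2⟩
  | mul r s hr hs => exact ⟨hr h.1, hs h.2⟩
  | inv r hr => exact ⟨hr h.1, GenSeries.isUnit_of_constTerm (key r h.1 (hr h.1)) h.2⟩

end NCRatExpr

/-! ### Evaluation of generalized polynomials and series at generic matrices -/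

section Generic

open WordSeries

variable {F : Type u} [Field F] {g m : ℕ}

namespace GenPoly

/-- Generalized polynomials over `m × m` matrices as matrix valued series in the entries of generic
matrices. -/
noncomputable def toGeneric : GenPoly F (Matrix (Fin m) (Fin m) F) g →ₐ[F]
    WordSeries (Matrix (Fin m) (Fin m) F) (Fin g × Fin m × Fin m) :=
  LinearAlgebra.FreeProduct.lift F (GenPolyFactor F (Matrix (Fin m) (Fin m) F) g) fun {i} =>
    match i with
    | false => constHom F (Matrix (Fin m) (Fin m) F) (Fin g × Fin m × Fin m)
    | true => FreeAlgebra.lift F (genericPoint 0)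

theorem toGeneric_C (a : Matrix (Fin m) (Fin m) F) :
    toGeneric (C F (Matrix (Fin m) (Fin m) F) g a) = const a :=
  DFunLike.congr_fun (LinearAlgebra.FreeProduct.lift_comp_ι (i := false) F
    (GenPolyFactor F (Matrix (Fin m) (Fin m) F) g) _) a

theorem toGeneric_X (k : Fin g) :
    toGeneric (X F (Matrix (Fin m) (Fin m) F) g k) = genericPoint 0 k :=
  (DFunLike.congr_fun (LinearAlgebra.FreeProduct.lift_comp_ι (i := true) F
    (GenPolyFactor F (Matrix (Fin m) (Fin m) F) g) _) (FreeAlgebra.ι F k)).trans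
      (FreeAlgebra.lift_ι_apply _ _)

end GenPoly

end Generic

section Generic

open WordSeries

variable {F : Type u} [Field F] {g m : ℕ}

namespace WordSeries

theorem genericPoint_singleton (p : Fin g → Matrix (Fin m) (Fin m) F) (k : Fin g)
    (y : Fin g × Fin m × Fin m) :
    genericPoint p k [y] = if y.1 = k then single y.2.1 y.2.2 1 else 0 := rfl

/-- Series supported at the words over a given word in the letters `x_k`. -/
def homog (w : List (Fin g)) :
    Submodule F (WordSeries (Matrix (Fin m) (Fin m) F) (Fin g × Fin m × Fin m)) where
  carrier := {S | ∀ v, v.map Prod.fst ≠ w → S v = 0}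
  zero_mem' _ _ := rfl
  add_mem' {S T} hS hT v hv := by rw [add_apply, hS v hv, hT v hv, add_zero]
  smul_mem' α S hS v hv := by rw [smul_apply, hS v hv, smul_zero]

/-- Only the split after `|u|` letters can contribute. If `w` is shorter than `u`, both sides
vanish, as `take` returns too short a word. -/
theorem mul_apply_of_homog {u : List (Fin g)}
    {S : WordSeries (Matrix (Fin m) (Fin m) F) (Fin g × Fin m × Fin m)} (hS : S ∈ homog u)
    (T : WordSeries (Matrix (Fin m) (Fin m) F) (Fin g × Fin m × Fin m))
    (w : List (Fin g × Fin m × Fin m)) :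
    (S * T) w = S (w.take u.length) * T (w.drop u.length) := by
  have h0 : ∀ v : List (Fin g × Fin m × Fin m), v.length ≠ u.length → S v = 0 := fun v hv =>
    hS v fun h => hv (by rw [← h, List.length_map])
  rw [mul_apply]
  by_cases h : u.length ≤ w.length
  · refine Finset.sum_eq_single _ (fun i hi hne => ?_) fun h' => ?_
    · rw [h0, zero_mul]
      simp at hi ⊢
      omega
    · simp at h'
      omega
  · rw [Finset.sum_eq_zero, h0, zero_mul]
    · simp
      omega
    · intro i hi
      rw [h0, zero_mul]
      simp at hi ⊢
      omega

theorem mul_mem_homog {u v : List (Fin g)}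
    {S T : WordSeries (Matrix (Fin m) (Fin m) F) (Fin g × Fin m × Fin m)} (hS : S ∈ homog u)
    (hT : T ∈ homog v) : S * T ∈ homog (u ++ v) := by
  intro w hw
  rw [mul_apply_of_homog hS]
  by_cases h : (w.take u.length).map Prod.fst = u
  · rw [hT, mul_zero]
    intro h'
    apply hw
    rw [← List.take_append_drop u.length w, List.map_append, h, h']
  · rw [hS _ h, zero_mul]

theorem const_mem_homog (a : Matrix (Fin m) (Fin m) F) :
    (const a : WordSeries _ (Fin g × Fin m × Fin m)) ∈ homog [] := by
  intro v hv
  cases v with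
  | nil => exact absurd rfl hv
  | cons y v => rfl

theorem genericPoint_zero_mem_homog (k : Fin g) :
    (genericPoint 0 k : WordSeries (Matrix (Fin m) (Fin m) F) _) ∈ homog [k] := by
  intro v hv
  match v with
  | [] => rfl
  | [y] =>
    have : y.1 ≠ k := fun h => hv (by simp [h])
    simp [genericPoint, this]
  | _ :: _ :: _ => rfl

end WordSeries

namespace GenPoly

local notation "𝔸" => Matrix (Fin m) (Fin m) F

theorem toGeneric_mem_homog_letter {k : Fin g} {x : GenPoly F 𝔸 g}
    (hx : x ∈ letterBimod F 𝔸 g k) : toGeneric x ∈ homog [k] := by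
  refine letterBimod_induction (P := fun x => toGeneric x ∈ homog [k]) (fun a b => ?_)
    (fun x y h1 h2 => ?_) hx
  · rw [map_mul, map_mul, toGeneric_C, toGeneric_C, toGeneric_X]
    exact mul_mem_homog (mul_mem_homog (const_mem_homog a) (genericPoint_zero_mem_homog k))
      (const_mem_homog b)
  · rw [map_add]
    exact Submodule.add_mem _ h1 h2

theorem toGeneric_mem_homog {w : List (Fin g)} {x : GenPoly F 𝔸 g}
    (hx : x ∈ wordBimod F 𝔸 g w) : toGeneric x ∈ homog w := by
  induction w generalizing x with
  | nil =>
    obtain ⟨a, rfl⟩ := hx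
    change toGeneric (C F 𝔸 g a) ∈ _
    rw [toGeneric_C]
    exact const_mem_homog a
  | cons k w ih =>
    refine Submodule.mul_induction_on hx (fun y hy z hz => ?_) fun y z h1 h2 => ?_
    · rw [map_mul]
      exact mul_mem_homog (toGeneric_mem_homog_letter hy) (ih hz)
    · rw [map_add]
      exact Submodule.add_mem _ h1 h2

/-- Recovers an element of `A^w` from the matrix valued series. -/
noncomputable def ofGeneric : List (Fin g) → WordSeries 𝔸 (Fin g × Fin m × Fin m) →
    GenPoly F 𝔸 g
  | [], S => C F 𝔸 g (S [])
  -- At the letter `(k, c, d)` the element `α x_k β z` has coefficient `α E_cd β z`. Left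
  -- multiplication by `E_da` leaves `α_ac E_dd β z`; summing these against `E_ac x_k` restores the
  -- element.
  | k :: w, S => ∑ a : Fin m, ∑ c : Fin m, ∑ d : Fin m, C F 𝔸 g (single a c 1) * X F 𝔸 g k *
      ofGeneric w (constMul (single d a 1) (shift (k, c, d) S))

theorem ofGeneric_add (w : List (Fin g)) (S T : WordSeries 𝔸 (Fin g × Fin m × Fin m)) :
    ofGeneric w (S + T) = ofGeneric w S + ofGeneric w T := by
  induction w generalizing S T with
  | nil => exact map_add _ _ _
  | cons k w ih =>
    simp only [ofGeneric, ← Finset.sum_add_distrib]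
    refine Finset.sum_congr rfl fun a _ => Finset.sum_congr rfl fun c _ =>
      Finset.sum_congr rfl fun d _ => ?_
    have : constMul (single d a (1 : F)) (shift (k, c, d) (S + T)) =
        constMul (single d a 1) (shift (k, c, d) S) + constMul (single d a 1) (shift (k, c, d) T) :=
      WordSeries.ext fun v => mul_add (single d a (1 : F)) (S _) (T _)
    rw [← mul_add, ← ih, this]

theorem sum_single_eq_one : ∑ d : Fin m, single d d (1 : F) = (1 : 𝔸) := by
  ext i j
  simp [Matrix.sum_apply, single_apply, one_apply, ite_and]

/-- This left inverse on `A^w` makes the passage to generic matrices faithful without a basis of the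
free product. -/
theorem ofGeneric_toGeneric {w : List (Fin g)} {x : GenPoly F 𝔸 g}
    (hx : x ∈ wordBimod F 𝔸 g w) : ofGeneric w (toGeneric x) = x := by
  induction w generalizing x with
  | nil =>
    obtain ⟨a, rfl⟩ := hx
    change ofGeneric [] (toGeneric (C F 𝔸 g a)) = C F 𝔸 g a
    rw [toGeneric_C]
    rfl
  | cons k w ih =>
    refine Submodule.mul_induction_on hx (fun y hy z hz => ?_) fun y z h1 h2 => ?_
    · refine letterBimod_induction (P := fun y => ofGeneric (k :: w) (toGeneric (y * z)) = y * z)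
        (fun α β => ?_) (fun y y' h1 h2 => ?_) hy
      · have h1 : ∀ a c d : Fin m, ofGeneric w (constMul (single d a 1)
            (shift (k, c, d) (toGeneric (C F 𝔸 g α * X F 𝔸 g k * C F 𝔸 g β * z)))) =
            C F 𝔸 g (α a c • (single d d 1 * β)) * z := by
          intro a c d
          rw [← ih (C_mul_mem_wordBimod F 𝔸 g (α a c • (single d d 1 * β)) hz)]
          congr 1
          refine WordSeries.ext fun v => ?_
          simp only [constMul, shift, map_mul, toGeneric_C, toGeneric_X, mul_assoc, const_mul_apply,
            genericPoint_mul_cons, Pi.zero_apply, zero_mul, zero_add, if_true]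
          rw [← mul_assoc, ← mul_assoc, smul_mul_assoc, mul_assoc (single d d 1),
            ← smul_mul_assoc]
          congr 1
          ext i j
          simp [single_mul_mul_single, single_apply]
        simp only [ofGeneric, h1]
        simp only [map_smul, map_mul, smul_mul_assoc, mul_smul_comm]
        have h2 : ∀ a c : Fin m, ∑ d : Fin m, α a c • (C F 𝔸 g (single a c 1) * X F 𝔸 g k *
            (C F 𝔸 g (single d d 1) * C F 𝔸 g β * z)) =
            C F 𝔸 g (α a c • single a c 1) * (X F 𝔸 g k * (C F 𝔸 g β * z)) := by
          intro a c
          rw [← Finset.smul_sum, ← Finset.mul_sum, ← Finset.sum_mul, ← Finset.sum_mul, ← map_sum,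
            sum_single_eq_one, map_one, one_mul, map_smul, smul_mul_assoc, mul_assoc]
        simp only [h2, ← Finset.sum_mul, ← map_sum]
        have h3 : ∑ a : Fin m, ∑ c : Fin m, α a c • single a c (1 : F) = α := by
          conv_rhs => rw [matrix_eq_sum_single α]
          simp
        rw [h3, mul_assoc, mul_assoc]
      · simp only [add_mul, map_add, ofGeneric_add] at h1 h2 ⊢
        rw [h1, h2]
    · rw [map_add, ofGeneric_add, h1, h2]

theorem eq_of_toGeneric_eq {w : List (Fin g)} {x y : GenPoly F 𝔸 g}
    (hx : x ∈ wordBimod F 𝔸 g w) (hy : y ∈ wordBimod F 𝔸 g w)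
    (h : ∀ v, v.map Prod.fst = w → toGeneric x v = toGeneric y v) : x = y := by
  rw [← ofGeneric_toGeneric hx, ← ofGeneric_toGeneric hy]
  congr 1
  refine WordSeries.ext fun v => ?_
  by_cases hv : v.map Prod.fst = w
  · exact h v hv
  · rw [toGeneric_mem_homog hx v hv, toGeneric_mem_homog hy v hv]

end GenPoly

namespace GenSeries

local notation "𝔸" => Matrix (Fin m) (Fin m) F

/-- Generalized series over matrices as matrix valued series in the entries of generic matrices. -/
noncomputable def toGeneric : GenSeries F 𝔸 g →ₐ[F] WordSeries 𝔸 (Fin g × Fin m × Fin m) :=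
  AlgHom.ofLinearMap
    { toFun := fun S v => GenPoly.toGeneric (S.1 (v.map Prod.fst)) v
      map_add' := fun S T => WordSeries.ext fun v => by
        change GenPoly.toGeneric (S.1 _ + T.1 _) v = _
        rw [map_add]
        rfl
      map_smul' := fun α S => WordSeries.ext fun v => by
        change GenPoly.toGeneric (α • S.1 _) v = _
        rw [map_smul]
        rfl }
    (WordSeries.ext fun v => by
      cases v with
      | nil =>
        change GenPoly.toGeneric 1 [] = _
        rw [map_one]
      | cons y v =>
        change GenPoly.toGeneric 0 (y :: v) = _
        rw [map_zero]
        rfl)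
    (fun S T => WordSeries.ext fun v => by
      change GenPoly.toGeneric ((S.1 * T.1) (v.map Prod.fst)) v = _
      rw [WordSeries.mul_apply, WordSeries.mul_apply, map_sum, WordSeries.sum_apply,
        List.length_map]
      refine Finset.sum_congr rfl fun i hi => ?_
      have hi' : ((v.map Prod.fst).take i).length = i := by
        simp at hi ⊢
        omega
      -- The image of `[S, u]` lives on words of length `|u| = i`, so each splitting below produces
      -- exactly one splitting above.
      rw [map_mul, WordSeries.mul_apply_of_homog (GenPoly.toGeneric_mem_homog (S.2 _)), hi',
        ← List.map_take, ← List.map_drop]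
      rfl)

theorem toGeneric_apply (S : GenSeries F 𝔸 g) (v : List (Fin g × Fin m × Fin m)) :
    toGeneric S v = GenPoly.toGeneric (S.1 (v.map Prod.fst)) v := rfl

theorem toGeneric_letterAdd (k : Fin g) (a : Fin g → 𝔸) :
    toGeneric (letterAdd F 𝔸 g k (a k)) = genericPoint a k := by
  refine WordSeries.ext fun v => ?_
  rw [toGeneric_apply]
  match v with
  | [] =>
    change GenPoly.toGeneric (GenPoly.C F 𝔸 g (a k)) [] = _
    rw [GenPoly.toGeneric_C]
    rfl
  | [y] =>
    change GenPoly.toGeneric (if y.1 = k then GenPoly.X F 𝔸 g k else 0) [y] =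
      if y.1 = k then single y.2.1 y.2.2 1 else 0
    split_ifs with h
    · rw [GenPoly.toGeneric_X, genericPoint_singleton, if_pos h]
    · rw [map_zero]
      rfl
  | _ :: _ :: _ =>
    change GenPoly.toGeneric 0 _ = _
    rw [map_zero]
    rfl

end GenSeries

namespace NCRatExpr

/-- Definedness passes from `p` to the series `x + p`, and from there along a homomorphism to the
generic point. -/
theorem definedAt_genericPoint {r : NCRatExpr F g} {p : Fin g → Matrix (Fin m) (Fin m) F}
    (h : r.DefinedAt p) : r.DefinedAt (genericPoint p) ∧
      GenSeries.toGeneric (r.expansion p) = r.genericSeries p := by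
  have h1 := definedAt_map GenSeries.toGeneric (definedAt_letterAdd h)
  simp only [GenSeries.toGeneric_letterAdd] at h1
  exact ⟨h1.1, h1.2.symm⟩

end NCRatExpr

end Generic

/-! ### Linear representations over matrices as state spaces over the field -/

namespace LinRep

open WordSeries

variable {F : Type u} [Field F] {g m n : ℕ}

local notation "𝔸" => Matrix (Fin m) (Fin m) F

/-- The coefficients of the matrices of a linear representation over matrices. -/
noncomputable def stateMatrix (ρ : LinRep F 𝔸 g n) (y : Fin g × Fin m × Fin m) :
    Matrix (Fin n) (Fin n) 𝔸 :=
  Matrix.of fun i j => GenPoly.toGeneric (ρ.mat y.1 i j) [y]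

/-- The state operators over the field of a linear representation over matrices. -/
noncomputable def stateOp (ρ : LinRep F 𝔸 g n) (y : Fin g × Fin m × Fin m) :
    Module.End F (Fin n × Fin m → F) :=
  Matrix.mulVecLin (Matrix.comp _ _ _ _ F (ρ.stateMatrix y))

/-- The input vectors over the field of a linear representation over matrices. -/
def stateIn (ρ : LinRep F 𝔸 g n) (β : Fin m) : Fin n × Fin m → F :=
  fun iα => ρ.b iα.1 iα.2 β

/-- The output functionals over the field of a linear representation over matrices. -/
noncomputable def stateOut (ρ : LinRep F 𝔸 g n) (α : Fin m) : (Fin n × Fin m → F) →ₗ[F] F :=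
  ∑ i, ∑ γ, ρ.c i α γ • LinearMap.proj (i, γ)

/-- The state column `A^w b`. -/
noncomputable def stateCol (ρ : LinRep F 𝔸 g n) (w : List (Fin g)) (i : Fin n) :
    GenPoly F 𝔸 g :=
  ∑ j, (w.map ρ.mat).prod i j * GenPoly.C F 𝔸 g (ρ.b j)

theorem stateCol_nil (ρ : LinRep F 𝔸 g n) (i : Fin n) :
    ρ.stateCol [] i = GenPoly.C F 𝔸 g (ρ.b i) := by
  simp [stateCol, one_apply, ite_mul]

theorem stateCol_cons (ρ : LinRep F 𝔸 g n) (k : Fin g) (w : List (Fin g)) (i : Fin n) :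
    ρ.stateCol (k :: w) i = ∑ l, ρ.mat k i l * ρ.stateCol w l := by
  simp only [stateCol, List.map_cons, List.prod_cons, Matrix.mul_apply, Finset.sum_mul,
    Finset.mul_sum, mul_assoc]
  exact Finset.sum_comm

theorem value_eq (ρ : LinRep F 𝔸 g n) (w : List (Fin g)) :
    ρ.value w = ∑ i, GenPoly.C F 𝔸 g (ρ.c i) * ρ.stateCol w i := by
  simp only [value, stateCol, Finset.mul_sum, mul_assoc]

theorem stateCol_mem (ρ : LinRep F 𝔸 g n) (w : List (Fin g)) (i : Fin n) :
    ρ.stateCol w i ∈ GenPoly.wordBimod F 𝔸 g w := by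
  induction w generalizing i with
  | nil =>
    rw [stateCol_nil]
    exact GenPoly.C_mem_wordBimod F 𝔸 g _
  | cons k w ih =>
    rw [stateCol_cons]
    exact Submodule.sum_mem _ fun l _ => Submodule.mul_mem_mul (ρ.mat_mem k i l) (ih l)

theorem value_mem (ρ : LinRep F 𝔸 g n) (w : List (Fin g)) :
    ρ.value w ∈ GenPoly.wordBimod F 𝔸 g w := by
  rw [value_eq]
  exact Submodule.sum_mem _ fun i _ => GenPoly.C_mul_mem_wordBimod F 𝔸 g _ (ρ.stateCol_mem w i)

theorem toGeneric_stateCol (ρ : LinRep F 𝔸 g n) (v : List (Fin g × Fin m × Fin m)) (i : Fin n)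
    (α β : Fin m) : GenPoly.toGeneric (ρ.stateCol (v.map Prod.fst) i) v α β =
      (v.map ρ.stateOp).prod (ρ.stateIn β) (i, α) := by
  induction v generalizing i α with
  | nil =>
    rw [List.map_nil, stateCol_nil, GenPoly.toGeneric_C]
    rfl
  | cons y v ih =>
    have h : (v.map ρ.stateOp).prod (ρ.stateIn β) =
        fun jγ => GenPoly.toGeneric (ρ.stateCol (v.map Prod.fst) jγ.1) v jγ.2 β :=
      funext fun jγ => (ih jγ.1 jγ.2).symm
    rw [List.map_cons, List.map_cons, List.prod_cons, Module.End.mul_apply, h, stateOp,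
      mulVecLin_apply, LinPencil.comp_mulVec _ fun j =>
        GenPoly.toGeneric (ρ.stateCol (v.map Prod.fst) j) v, stateCol_cons, map_sum,
      WordSeries.sum_apply]
    refine congrFun (congrFun (Finset.sum_congr rfl fun l _ => ?_) α) β
    rw [map_mul, mul_apply_of_homog (GenPoly.toGeneric_mem_homog_letter (ρ.mat_mem y.1 i l))]
    rfl

theorem toGeneric_value (ρ : LinRep F 𝔸 g n) (v : List (Fin g × Fin m × Fin m)) (α β : Fin m) :
    GenPoly.toGeneric (ρ.value (v.map Prod.fst)) v α β =
      ρ.stateOut α ((v.map ρ.stateOp).prod (ρ.stateIn β)) := by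
  rw [value_eq, map_sum, WordSeries.sum_apply, Matrix.sum_apply]
  simp only [map_mul, GenPoly.toGeneric_C, const_mul_apply, Matrix.mul_apply, toGeneric_stateCol]
  simp [stateOut]

/-- Both `[S, w]` and `c A^w b` lie in `A^w`, where generic matrices detect equality; entrywise the
representation is a state space system on `F^(nm)`. -/
theorem represents_iff (ρ : LinRep F 𝔸 g n) (S : GenSeries F 𝔸 g) :
    ρ.Represents S ↔ Realizes ρ.stateOp ρ.stateIn ρ.stateOut (GenSeries.toGeneric S) := by
  constructor
  · intro h v α β
    rw [GenSeries.toGeneric_apply, h, toGeneric_value]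
  · intro h w
    refine GenPoly.eq_of_toGeneric_eq (S.2 w) (ρ.value_mem w) fun v hv => ?_
    subst hv
    ext α β
    rw [toGeneric_value]
    exact h v α β

/-- Prescribing the state operators of a linear representation. -/
theorem exists_stateOp_eq (A : Fin g × Fin m × Fin m → Module.End F (Fin n × Fin m → F))
    (b : Fin m → Fin n × Fin m → F) (c : Fin m → (Fin n × Fin m → F) →ₗ[F] F) :
    ∃ ρ : LinRep F 𝔸 g n, ρ.stateOp = A ∧ ρ.stateIn = b ∧ ρ.stateOut = c := by
  let M (y : Fin g × Fin m × Fin m) := LinearMap.toMatrix' (A y)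
  let ρ : LinRep F 𝔸 g n :=
    { c := fun i => Matrix.of fun α γ => c α (Pi.single (i, γ) 1)
      b := fun i => Matrix.of fun α β => b β (i, α)
      -- The element `E_αs x_k E_tβ` takes the value `E_αβ` at the letter `(k, s, t)` and vanishes
      -- at all other letters, so any operators can be prescribed.
      mat := fun k => Matrix.of fun i j => ∑ s, ∑ t, ∑ α, ∑ β, M (k, s, t) (i, α) (j, β) •
        (GenPoly.C F 𝔸 g (single α s 1) * GenPoly.X F 𝔸 g k * GenPoly.C F 𝔸 g (single t β 1))
      mat_mem := fun k i j => by
        rw [of_apply]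
        exact Submodule.sum_mem _ fun s _ => Submodule.sum_mem _ fun t _ =>
          Submodule.sum_mem _ fun α _ => Submodule.sum_mem _ fun β _ => Submodule.smul_mem _ _
            (GenPoly.C_mul_X_mul_C_mem F 𝔸 g k _ _) }
  refine ⟨ρ, ?_, rfl, ?_⟩
  · funext y
    have h1 : Matrix.comp _ _ _ _ F (ρ.stateMatrix y) = M y := by
      ext ⟨i, α⟩ ⟨j, β⟩
      obtain ⟨k, s, t⟩ := y
      rw [comp_apply]
      simp only [stateMatrix, ρ, of_apply, map_sum, map_smul, map_mul, GenPoly.toGeneric_C,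
        GenPoly.toGeneric_X, WordSeries.sum_apply, WordSeries.smul_apply, mul_assoc,
        const_mul_apply, genericPoint_mul_cons, Pi.zero_apply, zero_mul, zero_add, if_true,
        const_nil]
      simp only [← mul_assoc, single_mul_mul_single, Matrix.sum_apply, Matrix.smul_apply]
      simp [single_apply, ite_and]
    rw [stateOp, h1]
    exact Matrix.toLin'_toMatrix' (A y)
  · funext α
    refine LinearMap.pi_ext' fun iγ => LinearMap.ext_ring ?_
    simp only [stateOut, ρ, of_apply, LinearMap.comp_apply, LinearMap.sum_apply,
      LinearMap.smul_apply, LinearMap.proj_apply, LinearMap.coe_single, smul_eq_mul]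
    rw [Fintype.sum_prod_type' (f := fun i γ => c α (Pi.single (i, γ) 1) *
      (Pi.single iγ (1 : F) : Fin n × Fin m → F) (i, γ)) |>.symm]
    simp [Pi.single_apply]

/-- The dimensions of the linear representations of a series over matrices. -/
theorem exists_represents_iff (S : GenSeries F 𝔸 g)
    [FiniteDimensional F (hankelSpace (GenSeries.toGeneric S))] :
    (∃ ρ : LinRep F 𝔸 g n, ρ.Represents S) ↔
      Module.finrank F (hankelSpace (GenSeries.toGeneric S)) ≤ n * m := by
  have hdim : Module.finrank F (Fin n × Fin m → F) = n * m := by simp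
  constructor
  · rintro ⟨ρ, hρ⟩
    exact ((ρ.represents_iff S).1 hρ).finrank_hankelSpace_le.trans hdim.le
  · intro h
    obtain ⟨A, b, c, hr⟩ := exists_realizes_of_finrank_le (h.trans hdim.ge)
    obtain ⟨ρ, rfl, rfl, rfl⟩ := exists_stateOp_eq A b c
    exact ⟨ρ, (ρ.represents_iff S).2 hr⟩

end LinRep

/-! ### Comparison of Hankel ranks across points, sizes and representatives -/

namespace NCRatExpr

open WordSeries

variable {F : Type u} [Field F] {g : ℕ}

/-- The dimension of the Hankel space of the expansion of `r` about `p`. -/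
noncomputable def hankelRank {m : ℕ} (r : NCRatExpr F g)
    (p : Fin g → Matrix (Fin m) (Fin m) F) : ℕ :=
  Module.finrank F (hankelSpace (r.genericSeries p))

theorem exists_represents_expansion_iff {m n : ℕ} {r : NCRatExpr F g}
    {p : Fin g → Matrix (Fin m) (Fin m) F} (hp : r.DefinedAt p) :
    (∃ ρ : LinRep F (Matrix (Fin m) (Fin m) F) g n, ρ.Represents (r.expansion p)) ↔
      r.hankelRank p ≤ n * m := by
  obtain ⟨h1, h2⟩ := definedAt_genericPoint hp
  have := finiteDimensional_hankelSpace hp h1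
  rw [← h2] at this
  rw [LinRep.exists_represents_iff, h2]
  rfl

theorem hankelRank_amplify {m k N : ℕ} (e : Fin m × Fin k ≃ Fin N) {r : NCRatExpr F g}
    {p : Fin g → Matrix (Fin m) (Fin m) F} (hp : r.DefinedAt p) :
    r.hankelRank (fun l => amplify e (p l)) = k * r.hankelRank p := by
  have h1 := (definedAt_genericPoint hp).1
  have : FiniteDimensional F (hankelSpace (r.eval (genericPoint p))) :=
    finiteDimensional_hankelSpace hp h1
  have h2 := definedAt_map (amplifySeries e) h1
  simp only [amplifySeries_genericPoint] at h2
  rw [hankelRank, genericSeries, h2.2]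
  exact finrank_hankelSpace_amplifySeries e _

/-- The Hankel ranks of the expansions of expressions that agree are proportional to the sizes of
the matrix points. -/
theorem Agree.mul_hankelRank_eq [Infinite F] {r s : NCRatExpr F g} (h : r.Agree s) {m k : ℕ}
    (hm : 0 < m) (hk : 0 < k) {p : Fin g → Matrix (Fin m) (Fin m) F}
    {q : Fin g → Matrix (Fin k) (Fin k) F} (hp : r.DefinedAt p) (hq : s.DefinedAt q) :
    k * r.hankelRank p = m * s.hankelRank q := by
  let e := finProdFinEquiv (m := m) (n := k)
  have h1 := (definedAt_map (amplify (F := F) e) hp).1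
  have h2 := (definedAt_map (amplify (F := F) ((Equiv.prodComm _ _).trans e)) hq).1
  -- At the common point `a` of size `m k` the chain is `k h_r(p) = h_r(p ⊗ 1) = h_r(a) = h_s(a) =
  -- h_s(q ⊗ 1) = m h_s(q)`.
  obtain ⟨a, har, has⟩ := exists_definedAt_both h1 h2
  rw [← hankelRank_amplify e hp, ← hankelRank_amplify ((Equiv.prodComm _ _).trans e) hq]
  have har' := (definedAt_genericPoint har).1
  have has' := (definedAt_genericPoint has).1
  refine (finrank_hankelSpace_eq h1 (definedAt_genericPoint h1).1 har har').trans ?_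
  rw [h.genericSeries_eq (Nat.mul_pos hm hk) har' has']
  exact finrank_hankelSpace_eq has has' h2 (definedAt_genericPoint h2).1

end NCRatExpr

theorem theorem5p8 {F : Type*} [Field F] [CharZero F] {g : ℕ} (f : NCRatFun F g) :
    ∃! n : ℕ, ∀ m : ℕ, 0 < m → ∀ p ∈ f.dom m, ∀ k : ℕ,
      (∃ ρ : LinRep F (Matrix (Fin m) (Fin m) F) g k, f.IsMinimalRealization p ρ) ↔ k = n := by
  obtain ⟨⟨r, hr⟩, hf⟩ := Quot.exists_rep f
  have hrf : f.IsRepresentedBy r := ⟨hr, hf.symm⟩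
  obtain ⟨m₀, hm₀, p₀, hp₀⟩ := id hr
  have hex : ∃ n, r.hankelRank p₀ ≤ n * m₀ := ⟨_, Nat.le_mul_of_pos_right _ hm₀⟩
  -- Ranks proportional to the sizes satisfy `h ≤ n m` for the same `n`. The Sylvester degree is
  -- thus obtained as the least such `n`, with no need for `m` to divide `h`.
  have hrank : ∀ m : ℕ, 0 < m → ∀ p : Fin g → Matrix (Fin m) (Fin m) F, ∀ s : NCRatExpr F g,
      f.IsRepresentedBy s → s.DefinedAt p → ∀ n,
        s.hankelRank p ≤ n * m ↔ r.hankelRank p₀ ≤ n * m₀ := by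
    intro m hm p s hs hp n
    have h := (hs.agree hrf).mul_hankelRank_eq hm hm₀ hp hp₀
    constructor
    · intro h1
      refine le_of_mul_le_mul_left (a := m) ?_ hm
      rw [← h]
      exact (Nat.mul_le_mul_left m₀ h1).trans (le_of_eq (by ring))
    · intro h1
      refine le_of_mul_le_mul_left (a := m₀) ?_ hm₀
      rw [h]
      exact (Nat.mul_le_mul_left m h1).trans (le_of_eq (by ring))
  classical
  have key : ∀ m : ℕ, 0 < m → ∀ p ∈ f.dom m, ∀ k : ℕ,
      (∃ ρ : LinRep F (Matrix (Fin m) (Fin m) F) g k, f.IsMinimalRealization p ρ) ↔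
        k = Nat.find hex := by
    rintro m hm p ⟨s, hs, hp⟩ k
    constructor
    -- The given realization may use a representative `t` other than `s`; the bound holds for every
    -- representative defined at `p`.
    · rintro ⟨ρ, t, ht, htp, hρ, hmin⟩
      have h1 := fun n => (NCRatExpr.exists_represents_expansion_iff (n := n) htp).trans
        (hrank m hm p t ht htp n)
      obtain ⟨σ, hσ⟩ := (h1 _).2 (Nat.find_spec hex)
      exact le_antisymm (hmin _ σ hσ) (Nat.find_min' hex ((h1 k).1 ⟨ρ, hρ⟩))
    · rintro rfl
      have h1 := fun n => (NCRatExpr.exists_represents_expansion_iff (n := n) hp).trans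
        (hrank m hm p s hs hp n)
      obtain ⟨σ, hσ⟩ := (h1 _).2 (Nat.find_spec hex)
      exact ⟨σ, s, hs, hp, hσ, fun l τ hτ => Nat.find_min' hex ((h1 l).1 ⟨τ, hτ⟩)⟩
  refine ⟨Nat.find hex, key, fun n hn => ?_⟩
  -- Uniqueness needs one point of the domain, which nondegeneracy provides.
  have hp : p₀ ∈ f.dom m₀ := ⟨r, hrf, hp₀⟩
  exact (hn m₀ hm₀ p₀ hp _).1 ((key m₀ hm₀ p₀ hp _).2 rfl) |>.symm
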